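/- Let $M$ be a smooth real $n$-manifold and let $p : Z \to M$ be a smooth bundle of tori $\mathbb T = \mathbb R^n/\mathbb Z^n$ (fibre dimension $n = \dim M$) with structure group $\mathrm{Aut}(\mathbb T) = GL(n,\mathbb Z)$, hence with a zero section $s$. Put $V = s^*T_{Z/M}$, let $\Lambda \subset V$ be the bundle of lattices with $Z = \mathrm{tot}(V)/\Lambda$, and equip $V$ with the flat connection for which the sections of $\Lambda$ are flat. The dual torus bundle is $\hat p : \hat Z = \mathrm{tot}(V^\vee)/\Lambda^\vee \to M$, with $\Lambda^\vee = \mathrm{Hom}(\Lambda,\mathbb Z)$. The flat connections split the tangent sequences, $T_Z \cong p^*V \oplus p^*T_M$ and $T_{\hat Z} \cong \hat p^*V^\vee \oplus \hat p^*T_M$, and so induce isometries $$F : T_Z \oplus T_Z^\vee \to p^*(V \oplus T_M \oplus V^\vee \oplus T_M^\vee), \qquad \hat F : T_{\hat Z} \oplus T_{\hat Z}^\vee \to \hat p^*(V^\vee \oplus T_M \oplus V \oplus T_M^\vee).$$ A generalized almost complex structure on a vector bundle $W$ is an automorphism of $W \oplus W^\vee$ that is orthogonal for the canonical pairing and has square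 $-1$; on a manifold $N$ it is one on $T_N$, and it is integrable (a generalized complex structure) if the sheaf of sections of its $+i$ eigenbundle in $(T_N \oplus T_N^\vee)\otimes\mathbb C$ is closed under the Courant bracket $$[X+\xi, Y+\eta] = [X,Y] + \mathcal L_X\eta - \mathcal L_Y\xi + \tfrac12 d(\iota_Y\xi - \iota_X\eta).$$ A generalized almost complex structure $\mathcal J$ on $Z$ is semi-flat if $\mathcal J = F^{-1}(p^*\underline{\mathcal J})F$ for a generalized almost complex structure $\underline{\mathcal J}$ on $V \oplus T_M$ that is adapted, i.e. $\underline{\mathcal J}(V \oplus V^\vee) = T_M \oplus T_M^\vee$. Semi-flat structures on $\hat Z$ are defined in the same way with $V^\vee$ and $\hat F$ in place of $V$ and $F$. The mirror structure of $\mathcal J$ is $\hat{\mathcal J} = \hat F^{-1}(\hat p^*\underline{\hat{\mathcal J}})\hat F$ on $\hat Z$, where $\underline{\hat{\mathcal J}}$ is $\underline{\mathcal J}$ transported by the exchange $V \oplus T_M \oplus V^\vee \oplus T_M^\vee \cong V^\vee \oplus T_M \oplus V \oplus T_M^\vee$. Then every semi-flat generalized almost complex structure $\mathcal J$ on $Z$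 has exactly one mirror structure $\hat{\mathcal J}$ on $\hat Z$; it is a semi-flat generalized almost complex structure, and $\mathcal J$ is integrable if and only if $\hat{\mathcal J}$ is integrable. Consequently $\mathcal J \mapsto \hat{\mathcal J}$ is a bijection from the semi-flat generalized complex structures on $Z$ to the semi-flat generalized complex structures on $\hat Z$. -/

import Mathlib

open Set Function Bundle Filter
open scoped Manifold ContDiff Topology

set_option linter.unusedSectionVars false

noncomputable section

namespace SemiFlat

section Linear
variable {W W₂ : Type*} [AddCommGroup W] [Module ℝ W] [TopologicalSpace W]
  [AddCommGroup W₂] [Module ℝ W₂] [TopologicalSpace W₂]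

/-- The space `W ⊕ W^∨`. -/
abbrev GenSpace (W : Type*) [AddCommGroup W] [Module ℝ W] [TopologicalSpace W] : Type _ :=
  W × (W →L[ℝ] ℝ)

/-- The canonical pairing `⟨v + f, w + g⟩ = -(f(w) + g(v)) / 2` on `W ⊕ W^∨`. -/
def pairing (a b : GenSpace W) : ℝ := -(1 / 2) * (a.2 b.1 + b.2 a.1)

/-- A generalized complex structure on the vector space `W`: an automorphism `J` of `W ⊕ W^∨` that is
orthogonal for the canonical pairing and satisfies `J ^ 2 = -1`. -/
structure IsGenComplex (J : GenSpace W →ₗ[ℝ] GenSpace W) : Prop where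
  sq : ∀ a, J (J a) = -a
  orthogonal : ∀ a b, pairing (J a) (J b) = pairing a b

/-- The vector `a + i b` of `(W ⊕ W^∨) ⊗ ℂ` lies in the `+i` eigenspace of `J`
(elements of the complexification are written through their real and imaginary parts). -/
def InEigenspace (J : GenSpace W →ₗ[ℝ] GenSpace W) (a b : GenSpace W) : Prop :=
  J a = -b ∧ J b = a

/-- The isomorphism `W ⊕ W^∨ ≃ W₂ ⊕ W₂^∨` induced by a linear isomorphism `W ≃ W₂`. -/
def genMap (e : W ≃L[ℝ] W₂) : GenSpace W ≃ₗ[ℝ] GenSpace W₂ where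
  toFun a := (e a.1, a.2.comp (e.symm : W₂ →L[ℝ] W))
  invFun a := (e.symm a.1, a.2.comp (e : W →L[ℝ] W₂))
  map_add' a b := by ext <;> simp
  map_smul' r a := by ext <;> simp
  left_inv a := by ext <;> simp
  right_inv a := by ext <;> simp
end Linear

section Manifold
variable {E : Type*} [NormedAddCommGroup E] [NormedSpace ℝ E]
  {H : Type*} [TopologicalSpace H] (I : ModelWithCorners ℝ E H)
  {N : Type*} [TopologicalSpace N] [ChartedSpace H N]

variable (N) in
/-- Sections (with no smoothness yet) of `T_N ⊕ T_N^∨`. -/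
abbrev GenSection : Type _ := ∀ z : N, GenSpace (TangentSpace I z)

variable {I} in
/-- The one-form `ι_u dξ` at `z`: the exterior derivative `dξ` is computed in the preferred chart at `z`
as `dξ(u, w) = u(ξ(w)) - w(ξ(u))` for chart-constant `u`, `w`. -/
def interiorExtDeriv (ξ : ∀ z : N, TangentSpace I z →L[ℝ] ℝ) (z : N) (u : TangentSpace I z) :
    TangentSpace I z →L[ℝ] ℝ :=
  let φ := extChartAt I z
  let ξφ : E → E →L[ℝ] ℝ := fun y =>
    (ξ (φ.symm y)).comp (mfderivWithin 𝓘(ℝ, E) I φ.symm (range I) y)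
  let D : E →L[ℝ] E →L[ℝ] ℝ := fderivWithin ℝ ξφ (range I) (φ z)
  let A : TangentSpace I z →L[ℝ] E := mfderiv I 𝓘(ℝ, E) φ z
  (D (A u) - D.flip (A u)).comp A

variable {I} in
/-- The differential `df` of a function, as a one-form. -/
def differential (f : N → ℝ) (z : N) : TangentSpace I z →L[ℝ] ℝ := mfderiv I 𝓘(ℝ, ℝ) f z

variable {I} in
/-- The Lie derivative of a one-form, `L_X η = ι_X dη + d(ι_X η)`. -/
def lieDerivative (X : ∀ z : N, TangentSpace I z) (η : ∀ z : N, TangentSpace I z →L[ℝ] ℝ) (z : N) :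
    TangentSpace I z →L[ℝ] ℝ :=
  interiorExtDeriv η z (X z) + differential (fun y => η y (X y)) z

variable {I} in
/-- The Courant bracket
`[X + ξ, Y + η] = [X, Y] + L_X η - L_Y ξ + d(ι_Y ξ - ι_X η) / 2` of real sections. -/
def courantBracket (a b : GenSection I N) : GenSection I N := fun z =>
  (VectorField.mlieBracket I (fun y => (a y).1) (fun y => (b y).1) z,
    lieDerivative (fun y => (a y).1) (fun y => (b y).2) z
      - lieDerivative (fun y => (b y).1) (fun y => (a y).2) z
      + (1 / 2 : ℝ) • differential (fun y => (a y).2 (b y).1 - (b y).2 (a y).1) z)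

variable [IsManifold I ∞ N]

variable {I} in
/-- Smoothness on `U` of a section of `T_N ⊕ T_N^∨`: both the vector field and the one-form are smooth
sections of the tangent and of the cotangent bundle. -/
def IsSmoothOn (a : GenSection I N) (U : Set N) : Prop :=
  ContMDiffOn I I.tangent ∞ (fun z => (⟨z, (a z).1⟩ : TangentBundle I N)) U ∧
  ContMDiffOn I (I.prod 𝓘(ℝ, E →L[ℝ] ℝ)) ∞
    (fun z => (⟨z, (a z).2⟩ :
      TotalSpace (E →L[ℝ] ℝ) (fun y : N => TangentSpace I y →L[ℝ] Bundle.Trivial N ℝ y))) U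

variable (N) in
/-- A generalized almost complex structure on the manifold `N`: a smooth automorphism of
`T_N ⊕ T_N^∨` that is a generalized complex structure on each fibre. Smooth means that it takes smooth
local sections to smooth local sections. -/
structure GenAlmostComplexStructure where
  toFun : ∀ z : N, GenSpace (TangentSpace I z) →ₗ[ℝ] GenSpace (TangentSpace I z)
  isGenComplex : ∀ z, IsGenComplex (toFun z)
  smooth : ∀ (U : Set N), IsOpen U → ∀ a : GenSection I N, IsSmoothOn a U →
    IsSmoothOn (fun z => toFun z (a z)) U

variable {I} in
/-- Integrability: the sheaf of (complex) smooth sections of the `+i` eigenbundle `E` is closed under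
the Courant bracket, extended `ℂ`-bilinearly: for sections `a + i a'` and `b + i b'` of `E`,
`[a + i a', b + i b'] = ([a, b] - [a', b']) + i ([a, b'] + [a', b])` is again a section of `E`. -/
def GenAlmostComplexStructure.Integrable (J : GenAlmostComplexStructure I N) : Prop :=
  ∀ U : Set N, IsOpen U → ∀ a a' b b' : GenSection I N,
    IsSmoothOn a U → IsSmoothOn a' U → IsSmoothOn b U → IsSmoothOn b' U →
    (∀ z ∈ U, InEigenspace (J.toFun z) (a z) (a' z)) →
    (∀ z ∈ U, InEigenspace (J.toFun z) (b z) (b' z)) →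
    ∀ z ∈ U, InEigenspace (J.toFun z)
      (courantBracket a b z - courantBracket a' b' z)
      (courantBracket a b' z + courantBracket a' b z)
end Manifold
section Descent
variable {E : Type*} [NormedAddCommGroup E] [NormedSpace ℝ E]
  {H : Type*} [TopologicalSpace H] {I : ModelWithCorners ℝ E H}
  {X : Type*} [TopologicalSpace X] [ChartedSpace H X]
  {Q : Type*} [TopologicalSpace Q]

variable (I) in
/-- Smooth deck transformations locally connect any two points of a fibre of `q`. -/
def HasSmoothDeck (q : X → Q) : Prop :=
  ∀ x y : X, q x = q y → ∃ τ : X → X, ContMDiffAt I I ∞ τ x ∧ τ x = y ∧ ∀ᶠ x' in 𝓝 x, q (τ x') = q x'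

variable {q : X → Q}

theorem contMDiffAt_localInverseAt_comp (hq : IsLocalHomeomorph q) (hd : HasSmoothDeck I q) (x a : X)
    (ha : q a ∈ (hq.localInverseAt x).source) :
    ContMDiffAt I I ∞ (fun a' => hq.localInverseAt x (q a')) a := by
  set s := hq.localInverseAt x with hs
  obtain ⟨τ, hτ, hτa, hτq⟩ := hd a (s (q a)) (hq.apply_localInverseAt_of_mem ha).symm
  refine hτ.congr_of_eventuallyEq ?_
  have h1 : ∀ᶠ a' in 𝓝 a, τ a' ∈ s.target := by
    apply hτ.continuousAt.eventually_mem
    rw [hτa]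
    exact s.open_target.mem_nhds (s.map_source ha)
  have h2 : ∀ᶠ a' in 𝓝 a, q a' ∈ s.source :=
    hq.continuous.continuousAt.eventually_mem (s.open_source.mem_nhds ha)
  filter_upwards [h1, h2, hτq] with a' h1 h2 h3
  refine hq.injOn_localInverseAt_target (x := x) (s.map_source h2) h1 ?_
  rw [h3]
  exact hq.apply_localInverseAt_of_mem h2


variable [IsManifold I ∞ X]

/-- The quotient of a smooth manifold by smooth deck transformations is a smooth manifold. -/
theorem isManifold_chartedSpace (hq : IsLocalHomeomorph q) (hs : Surjective q)
    (hd : HasSmoothDeck I q) :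
    let _ := hq.chartedSpace (H := H) hs
    IsManifold I ∞ Q := by
  intro _
  refine isManifold_of_contDiffOn I ∞ Q ?_
  rintro _ _ ⟨z₁, rfl⟩ ⟨z₂, rfl⟩
  set x₁ := (hs.hasRightInverse.choose) z₁
  set x₂ := (hs.hasRightInverse.choose) z₂
  set s₁ := hq.localInverseAt x₁ with hs₁
  set s₂ := hq.localInverseAt x₂ with hs₂
  rintro y ⟨hy, hyr⟩
  have hsymm : ∀ a, s₁.symm a = q a := fun a => by rw [hs₁, hq.localInverseAt_symm]
  simp only [mem_preimage, OpenPartialHomeomorph.trans_source, OpenPartialHomeomorph.symm_source,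
    OpenPartialHomeomorph.trans_target, OpenPartialHomeomorph.coe_trans_symm, mem_inter_iff,
    comp_apply, hsymm] at hy
  obtain ⟨⟨h1, h2⟩, h3, h4⟩ := hy
  have key := contMDiffAt_localInverseAt_comp hq hd x₂ _ h3
  rw [← contMDiffWithinAt_univ, contMDiffWithinAt_iff_of_mem_source (x := x₁) (y := x₂)
    ((chartAt H x₁).map_target h1) h4] at key
  have hpt : extChartAt I x₁ ((chartAt H x₁).symm (I.symm y)) = y := by
    simp only [extChartAt_coe, comp_apply]
    rw [(chartAt H x₁).right_inv h1, I.right_inv hyr]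
  have := key.2
  rw [hpt] at this
  simp only [preimage_univ, univ_inter] at this
  refine (this.mono inter_subset_right).congr ?_ ?_
  · intro w _
    simp [extChartAt, hsymm, hs₂]
  · simp [extChartAt, hsymm, hs₂]

/-- The quotient map by smooth deck transformations is a local diffeomorphism. -/
theorem isLocalDiffeomorph_of_deck (hq : IsLocalHomeomorph q) (hs : Surjective q)
    (hd : HasSmoothDeck I q) :
    let _ := hq.chartedSpace (H := H) hs
    IsLocalDiffeomorph I I ∞ q := by
  intro _ x
  have hman : IsManifold I ∞ Q := isManifold_chartedSpace hq hs hd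
  set s := hq.localInverseAt x with hs'
  have hsymm : ∀ a, s.symm a = q a := fun a => by rw [hs', hq.localInverseAt_symm]
  have hchart : ∀ z : Q, extChartAt I z =
      ((hq.localInverseAt (hs.hasRightInverse.choose z)).trans
        (chartAt H (hs.hasRightInverse.choose z))).extend I := fun z => rfl
  have hsmooth : ∀ a, ContMDiffAt I I ∞ q a := by
    intro a
    rw [contMDiffAt_iff_target]
    refine ⟨hq.continuous.continuousAt, ?_⟩
    set x₂ := hs.hasRightInverse.choose (q a) with hx₂
    have hx₂q : q x₂ = q a := hs.hasRightInverse.choose_spec (q a)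
    have hmem : q a ∈ (hq.localInverseAt x₂).source := by
      rw [← hx₂q]; simp
    have h1 := contMDiffAt_localInverseAt_comp hq hd x₂ a hmem
    have h2 : hq.localInverseAt x₂ (q a) = x₂ := by rw [← hx₂q]; simp
    have h3 : ContMDiffAt I 𝓘(ℝ, E) ∞ (extChartAt I x₂) (hq.localInverseAt x₂ (q a)) := by
      rw [h2]; exact contMDiffAt_extChartAt
    exact ContMDiffAt.comp (g := extChartAt I x₂) (f := fun a' => hq.localInverseAt x₂ (q a')) a h3 h1
  have hinv : ∀ z ∈ s.source, ContMDiffAt I I ∞ s z := by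
    intro z hz
    rw [contMDiffAt_iff_source]
    set x₂ := hs.hasRightInverse.choose z with hx₂
    have hx₂q : q x₂ = z := hs.hasRightInverse.choose_spec z
    have h1 := contMDiffAt_localInverseAt_comp hq hd x x₂ (by rw [hx₂q]; exact hz)
    have h2 : (hq.localInverseAt x₂) z = x₂ := by rw [← hx₂q]; simp
    have hp : extChartAt I z z = extChartAt I x₂ x₂ := by
      rw [hchart]
      simp [OpenPartialHomeomorph.extend, ← hx₂, h2]
    rw [hp]
    have h3 := contMDiffAt_iff_source.1 h1
    refine h3.congr ?_ ?_
    · intro w _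
      rw [hchart]
      simp [extChartAt, ← hx₂]
      rfl
    · rw [hchart]
      simp [extChartAt, ← hx₂]
      rfl
  let Φ : PartialDiffeomorph I I X Q ∞ :=
    { toFun := q
      invFun := s
      source := s.target
      target := s.source
      map_source' := fun a ha => by rw [← hsymm]; exact s.map_target ha
      map_target' := fun a ha => s.map_source ha
      left_inv' := fun a ha => by rw [← hsymm]; exact s.right_inv ha
      right_inv' := fun a ha => by rw [← hsymm]; exact s.left_inv ha
      open_source := s.open_target
      open_target := s.open_source
      contMDiffOn_toFun := fun a _ => (hsmooth a).contMDiffWithinAt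
      contMDiffOn_invFun := fun a ha => (hinv a ha).contMDiffWithinAt }
  exact PartialDiffeomorph.isLocalDiffeomorphAt (φ := Φ) (hx := hq.self_mem_localInverseAt_target (x := x))
end Descent

section Cocycle
variable {ι M : Type*} {n : ℕ} [TopologicalSpace M]

variable (ι M n) in
/-- A cocycle on `M` with values in the discrete group `GL(n, ℤ)`, the automorphism group of the torus
`𝕋 = ℝⁿ / ℤⁿ`: the transition functions of a bundle with structure group `GL(n, ℤ)`. The matrix
`transition i j x` changes coordinates from the `i`-th to the `j`-th trivialization. -/
structure LatticeCocycle where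
  baseSet : ι → Set M
  isOpen_baseSet : ∀ i, IsOpen (baseSet i)
  indexAt : M → ι
  mem_baseSet_at : ∀ x, x ∈ baseSet (indexAt x)
  transition : ι → ι → M → GL (Fin n) ℤ
  locallyConstant : ∀ i j, ∀ x ∈ baseSet i ∩ baseSet j,
    ∀ᶠ y in 𝓝 x, transition i j y = transition i j x
  transition_self : ∀ i, ∀ x ∈ baseSet i, transition i i x = 1
  transition_comp : ∀ i j k, ∀ x ∈ baseSet i ∩ baseSet j ∩ baseSet k,
    transition j k x * transition i j x = transition i k x

/-- The transposed inverse of an integral matrix. -/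
def contragredient (g : GL (Fin n) ℤ) : GL (Fin n) ℤ where
  val := ((g⁻¹ : GL (Fin n) ℤ) : Matrix (Fin n) (Fin n) ℤ).transpose
  inv := (g : Matrix (Fin n) (Fin n) ℤ).transpose
  val_inv := by
    rw [← Matrix.transpose_mul, ← Units.val_mul, mul_inv_cancel, Units.val_one,
      Matrix.transpose_one]
  inv_val := by
    rw [← Matrix.transpose_mul, ← Units.val_mul, inv_mul_cancel, Units.val_one,
      Matrix.transpose_one]

/-- The action of `GL(n, ℤ)` on `ℝⁿ`. -/
def realAction (g : GL (Fin n) ℤ) : (Fin n → ℝ) →L[ℝ] (Fin n → ℝ) :=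
  (Matrix.mulVecLin ((g : Matrix (Fin n) (Fin n) ℤ).map (Int.cast : ℤ → ℝ))).toContinuousLinearMap

theorem realAction_apply (g : GL (Fin n) ℤ) (v : Fin n → ℝ) :
    realAction g v = ((g : Matrix (Fin n) (Fin n) ℤ).map (Int.cast : ℤ → ℝ)).mulVec v := rfl

theorem realAction_one (v : Fin n → ℝ) : realAction (1 : GL (Fin n) ℤ) v = v := by
  rw [realAction_apply, Units.val_one, Matrix.map_one _ Int.cast_zero Int.cast_one,
    Matrix.one_mulVec]

theorem realAction_mul (g h : GL (Fin n) ℤ) (v : Fin n → ℝ) :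
    realAction (g * h) v = realAction g (realAction h v) := by
  rw [realAction_apply, realAction_apply, realAction_apply, Matrix.mulVec_mulVec, Units.val_mul]
  congr 1
  exact Matrix.map_mul (f := Int.castRingHom ℝ)

theorem realAction_int (g : GL (Fin n) ℤ) (k : Fin n → ℤ) :
    realAction g (fun a => (k a : ℝ)) =
      fun a => (((g : Matrix (Fin n) (Fin n) ℤ).mulVec k a : ℤ) : ℝ) := by
  funext a
  simp [realAction_apply, Matrix.mulVec, dotProduct]

namespace LatticeCocycle
variable (c : LatticeCocycle ι M n)

/-- The dual cocycle: the transition matrices are replaced by their transposed inverses. -/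
def dual : LatticeCocycle ι M n where
  baseSet := c.baseSet
  isOpen_baseSet := c.isOpen_baseSet
  indexAt := c.indexAt
  mem_baseSet_at := c.mem_baseSet_at
  transition i j x := contragredient (c.transition i j x)
  locallyConstant i j x hx := (c.locallyConstant i j x hx).mono fun _ h => by rw [h]
  transition_self i x hx := by
    rw [c.transition_self i x hx]
    ext : 1
    simp [contragredient]
  transition_comp i j k x hx := by
    rw [← c.transition_comp i j k x hx]
    ext : 1
    simp only [contragredient, Units.val_mul, mul_inv_rev, Matrix.transpose_mul]

/-- The flat vector bundle `V` with fibre `ℝⁿ` and transition matrices those of `c`. The frames of its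
local trivializations are flat, and their integral combinations form the lattice `Λ ⊆ V`.
The bundle of the dual cocycle is the dual bundle `V^∨` with its dual flat connection: in the frames
of the same index, the pairing of `V^∨` with `V` is the dot product of `ℝⁿ`. -/
def vectorBundle : VectorBundleCore ℝ M (Fin n → ℝ) ι where
  baseSet := c.baseSet
  isOpen_baseSet := c.isOpen_baseSet
  indexAt := c.indexAt
  mem_baseSet_at := c.mem_baseSet_at
  coordChange i j x := realAction (c.transition i j x)
  coordChange_self i x hx v := by rw [c.transition_self i x hx, realAction_one]
  continuousOn_coordChange i j x hx := by
    refine ContinuousAt.continuousWithinAt ?_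
    refine (continuousAt_const (y := realAction (c.transition i j x))).congr ?_
    filter_upwards [c.locallyConstant i j x hx] with y hy
    rw [hy]
  coordChange_comp i j k x hx v := by
    rw [← c.transition_comp i j k x hx, realAction_mul]

/-- The total space of `V`. -/
abbrev VTotal : Type _ := TotalSpace (Fin n → ℝ) c.vectorBundle.Fiber

/-- The fibre of `V` over `x`, read in the frame of index `c.indexAt x`. -/
abbrev V (x : M) : Type _ := c.vectorBundle.Fiber x

/-- The coordinates of a point of `V` over `x` in the frame of index `c.indexAt x`. -/
def fiberCoord (p : c.VTotal) : Fin n → ℝ := p.snd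

/-- The action of the lattice `Λ`: two points of `V` are equivalent when they lie over the same point of
`M` and differ by an element of `Λ`, that is by an integral combination of the frame. -/
def latticeSetoid : Setoid c.VTotal where
  r p q := p.proj = q.proj ∧ ∃ k : Fin n → ℤ,
    c.fiberCoord p = c.fiberCoord q + fun a => (k a : ℝ)
  iseqv := by
    refine ⟨fun p => ⟨rfl, 0, ?_⟩, ?_, ?_⟩
    · funext a; simp
    · rintro p q ⟨h, k, hk⟩
      refine ⟨h.symm, -k, ?_⟩
      rw [hk]; funext a; simp
    · rintro p q r ⟨h, k, hk⟩ ⟨h', k', hk'⟩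
      refine ⟨h.trans h', k + k', ?_⟩
      rw [hk, hk']; funext a; simp; ring

/-- The quotient `tot(V) / Λ`. -/
def Torus : Type _ := Quotient c.latticeSetoid

instance : TopologicalSpace c.Torus := inferInstanceAs (TopologicalSpace (Quotient c.latticeSetoid))

/-- The quotient map `tot(V) → tot(V) / Λ`. -/
def quot : c.VTotal → c.Torus := Quotient.mk c.latticeSetoid

/-- The projection `tot(V) / Λ → M`. -/
def torusProj : c.Torus → M := Quotient.lift TotalSpace.proj fun _ _ h => h.1


/-- The point of `V` over `x` with coordinates `v` in the `i`-th frame. -/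
def point (i : ι) (p : M × (Fin n → ℝ)) : c.VTotal :=
  (c.vectorBundle.localTriv i).toOpenPartialHomeomorph.symm p

theorem point_proj (i : ι) (p : M × (Fin n → ℝ)) : (c.point i p).proj = p.1 := rfl

theorem fiberCoord_point (i : ι) (p : M × (Fin n → ℝ)) :
    c.fiberCoord (c.point i p) = realAction (c.transition i (c.indexAt p.1) p.1) p.2 := rfl

theorem point_transition (i j : ι) (x : M) (hi : x ∈ c.baseSet i) (hj : x ∈ c.baseSet j)
    (v : Fin n → ℝ) : c.point j (x, realAction (c.transition i j x) v) = c.point i (x, v) := by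
  have : c.fiberCoord (c.point j (x, realAction (c.transition i j x) v)) =
      c.fiberCoord (c.point i (x, v)) := by
    rw [fiberCoord_point, fiberCoord_point, ← realAction_mul,
      c.transition_comp i j _ x ⟨⟨hi, hj⟩, c.mem_baseSet_at x⟩]
  exact congrArg (fun v : Fin n → ℝ => (⟨x, v⟩ : c.VTotal)) this

theorem exists_point (i : ι) (p : c.VTotal) (hp : p.proj ∈ c.baseSet i) :
    ∃ v, c.point i (p.proj, v) = p :=
  ⟨((c.vectorBundle.localTriv i) p).2,
    (c.vectorBundle.localTriv i).symm_apply_mk_proj (x := p) hp⟩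

theorem quot_point_eq_iff (i : ι) (x : M) (hi : x ∈ c.baseSet i) (v w : Fin n → ℝ) :
    c.quot (c.point i (x, v)) = c.quot (c.point i (x, w)) ↔
      ∃ k : Fin n → ℤ, v = w + fun a => (k a : ℝ) := by
  have hx := c.mem_baseSet_at x
  have h1 : c.transition (c.indexAt x) i x * c.transition i (c.indexAt x) x = 1 := by
    rw [c.transition_comp i _ i x ⟨⟨hi, hx⟩, hi⟩, c.transition_self i x hi]
  constructor
  · intro h
    obtain ⟨-, k, hk⟩ := Quotient.exact h
    rw [fiberCoord_point, fiberCoord_point] at hk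
    have := congrArg (realAction (c.transition (c.indexAt x) i x)) hk
    rw [map_add, ← realAction_mul, ← realAction_mul, h1, realAction_one, realAction_one,
      realAction_int] at this
    exact ⟨_, this⟩
  · rintro ⟨k, rfl⟩
    refine Quotient.sound
      ⟨rfl, (c.transition i (c.indexAt x) x : Matrix (Fin n) (Fin n) ℤ).mulVec k, ?_⟩
    rw [fiberCoord_point, fiberCoord_point, map_add, realAction_int]

/-- Translation by an integer vector in the `i`-th frame. -/
def translate (i : ι) (k : Fin n → ℤ) (p : c.VTotal) : c.VTotal :=
  c.point i (p.proj, (c.vectorBundle.localTriv i p).2 + fun a => (k a : ℝ))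

theorem quot_translate (i : ι) (k : Fin n → ℤ) (p : c.VTotal) (hp : p.proj ∈ c.baseSet i) :
    c.quot (c.translate i k p) = c.quot p := by
  have h : c.point i (p.proj, (c.vectorBundle.localTriv i p).2) = p :=
    (c.vectorBundle.localTriv i).symm_apply_mk_proj (x := p) hp
  conv_rhs => rw [← h]
  exact (c.quot_point_eq_iff i _ hp _ _).2 ⟨k, rfl⟩

theorem exists_translate {p q : c.VTotal} (h : c.quot p = c.quot q) (i : ι)
    (hp : p.proj ∈ c.baseSet i) : ∃ k, c.translate i k p = q := by
  have hpq : p.proj = q.proj := (Quotient.exact h).1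
  obtain ⟨v, hv⟩ := c.exists_point i p hp
  obtain ⟨w, hw⟩ := c.exists_point i q (hpq ▸ hp)
  rw [← hpq] at hw
  rw [← hv, ← hw] at h
  obtain ⟨k, hk⟩ := (c.quot_point_eq_iff i _ hp _ _).1 h.symm
  refine ⟨k, ?_⟩
  rw [← hw, hk, translate]
  congr 3
  have : (c.vectorBundle.localTriv i) (c.point i (p.proj, v)) = (p.proj, v) :=
    (c.vectorBundle.localTriv i).apply_symm_apply' hp
  conv_lhs => rw [← hv]
  exact congrArg Prod.snd this

theorem continuousOn_point (i : ι) : ContinuousOn (c.point i) (c.baseSet i ×ˢ univ) :=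
  (c.vectorBundle.localTriv i).toOpenPartialHomeomorph.continuousOn_symm

theorem isOpen_preimage_baseSet (i : ι) : IsOpen {p : c.VTotal | p.proj ∈ c.baseSet i} :=
  (c.vectorBundle.localTriv i).open_source

theorem continuousAt_translate (i : ι) (k : Fin n → ℤ) (p : c.VTotal) (hp : p.proj ∈ c.baseSet i) :
    ContinuousAt (c.translate i k) p := by
  have h0 : ContinuousAt (c.vectorBundle.localTriv i) p :=
    (c.vectorBundle.localTriv i).toOpenPartialHomeomorph.continuousAt hp
  have h1 : ContinuousAt (c.point i) (p.proj, (c.vectorBundle.localTriv i p).2 + fun a => (k a : ℝ)) :=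
    (c.continuousOn_point i).continuousAt
      (((c.isOpen_baseSet i).prod isOpen_univ).mem_nhds ⟨hp, mem_univ _⟩)
  exact ContinuousAt.comp (g := c.point i)
    (f := fun p => (p.proj, (c.vectorBundle.localTriv i p).2 + fun a => (k a : ℝ))) h1
    ((continuous_fst.continuousAt.comp h0).prodMk
      ((continuous_snd.continuousAt.comp h0).add continuousAt_const))

theorem continuous_quot : Continuous c.quot := continuous_quot_mk

theorem isOpenMap_quot : IsOpenMap c.quot := by
  intro U hU
  change IsOpen (c.quot ⁻¹' (c.quot '' U))
  rw [isOpen_iff_mem_nhds]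
  rintro p ⟨q, hq, hqp⟩
  obtain ⟨k, rfl⟩ := c.exists_translate hqp.symm (c.indexAt p.proj) (c.mem_baseSet_at _)
  have h := c.continuousAt_translate _ k p (c.mem_baseSet_at _)
  filter_upwards [h.eventually_mem (hU.mem_nhds hq),
    (c.isOpen_preimage_baseSet (c.indexAt p.proj)).mem_nhds (c.mem_baseSet_at _)] with p' h1 h2
  exact ⟨_, h1, c.quot_translate _ k p' h2⟩

theorem isLocalHomeomorph_quot : IsLocalHomeomorph c.quot := by
  rw [isLocalHomeomorph_iff_isOpenEmbedding_restrict]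
  intro p
  set i := c.indexAt p.proj with hi
  have hp : p.proj ∈ c.baseSet i := c.mem_baseSet_at _
  set e := c.vectorBundle.localTriv i with he
  have h0 : ContinuousAt e p := e.toOpenPartialHomeomorph.continuousAt hp
  have h1 : ∀ᶠ q in 𝓝 p, dist (e q).2 (e p).2 < 1 / 2 :=
    (continuous_snd.continuousAt.comp h0).eventually (Metric.ball_mem_nhds _ (by norm_num))
  have h2 : ∀ᶠ q in 𝓝 p, q.proj ∈ c.baseSet i := (c.isOpen_preimage_baseSet i).mem_nhds hp
  obtain ⟨U, hU, hUo, hpU⟩ := eventually_nhds_iff.1 (h1.and h2)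
  refine ⟨U, hUo.mem_nhds hpU, ?_⟩
  refine Topology.IsOpenEmbedding.of_continuous_injective_isOpenMap
    (c.continuous_quot.comp continuous_subtype_val) ?_ (c.isOpenMap_quot.domRestrict hUo)
  rintro ⟨q, hq⟩ ⟨r, hr⟩ hqr
  have hqr' : c.quot q = c.quot r := hqr
  obtain ⟨k, hk⟩ := c.exists_translate hqr' i (hU q hq).2
  have hek : (e r).2 = (e q).2 + fun a => (k a : ℝ) := by
    rw [← hk]
    have : e (c.point i (q.proj, (e q).2 + fun a => (k a : ℝ))) =
        (q.proj, (e q).2 + fun a => (k a : ℝ)) := e.apply_symm_apply' (hU q hq).2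
    exact congrArg Prod.snd this
  have hk0 : k = 0 := by
    funext a
    have hd : dist (e r).2 (e q).2 < 1 := by
      calc _ ≤ dist (e r).2 (e p).2 + dist (e q).2 (e p).2 := dist_triangle_right _ _ _
        _ < 1 := by linarith [(hU q hq).1, (hU r hr).1]
    have h3 : dist ((e r).2 a) ((e q).2 a) < 1 := (dist_le_pi_dist _ _ a).trans_lt hd
    rw [hek, Real.dist_eq] at h3
    simp only [Pi.add_apply, add_sub_cancel_left] at h3
    have : |k a| < 1 := by exact_mod_cast h3
    simpa using Int.abs_lt_one_iff.1 this
  apply Subtype.ext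
  change q = r
  rw [← hk, hk0]
  have : c.point i (q.proj, (e q).2) = q := e.symm_apply_mk_proj (x := q) (hU q hq).2
  have h4 : (e q).2 + (fun a => (((0 : Fin n → ℤ) a : ℤ) : ℝ)) = (e q).2 := by
    funext a; simp
  rw [translate, ← he, h4, this]

theorem surjective_quot : Surjective c.quot := Quotient.mk_surjective


section Smooth
variable [ChartedSpace (EuclideanSpace ℝ (Fin n)) M] [IsManifold (𝓡 n) ∞ M]

instance : c.vectorBundle.IsContMDiff (𝓡 n) ∞ where
  contMDiffOn_coordChange i j x hx := by
    refine ContMDiffAt.contMDiffWithinAt ?_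
    refine (contMDiffAt_const (c := realAction (c.transition i j x))).congr_of_eventuallyEq ?_
    filter_upwards [c.locallyConstant i j x hx] with y hy
    exact congrArg realAction hy

/-- The model of the `2n`-dimensional manifolds fibred over `M` with `n`-dimensional fibres. -/
abbrev totalModel (n : ℕ) : ModelWithCorners ℝ (EuclideanSpace ℝ (Fin n) × (Fin n → ℝ))
    (ModelProd (EuclideanSpace ℝ (Fin n)) (Fin n → ℝ)) := (𝓡 n).prod 𝓘(ℝ, Fin n → ℝ)

instance localTriv_mem (i : ι) : MemTrivializationAtlas (c.vectorBundle.localTriv i) :=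
  ⟨⟨i, rfl⟩⟩

theorem contMDiffOn_point (i : ι) :
    ContMDiffOn (totalModel n) (totalModel n) ∞ (c.point i) (c.baseSet i ×ˢ univ) :=
  Trivialization.contMDiffOn_symm (IB := 𝓡 n) (c.vectorBundle.localTriv i)

theorem contMDiffAt_localTriv (i : ι) (p : c.VTotal) (hp : p.proj ∈ c.baseSet i) :
    ContMDiffAt (totalModel n) (totalModel n) ∞ (c.vectorBundle.localTriv i) p :=
  (Trivialization.contMDiffOn (IB := 𝓡 n) (c.vectorBundle.localTriv i)).contMDiffAt
    ((c.isOpen_preimage_baseSet i).mem_nhds hp)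

theorem contMDiffAt_translate (i : ι) (k : Fin n → ℤ) (p : c.VTotal) (hp : p.proj ∈ c.baseSet i) :
    ContMDiffAt (totalModel n) (totalModel n) ∞ (c.translate i k) p := by
  have h0 := c.contMDiffAt_localTriv i p hp
  have h1 : ContMDiffAt (totalModel n) (totalModel n) ∞ (c.point i)
      (p.proj, (c.vectorBundle.localTriv i p).2 + fun a => (k a : ℝ)) :=
    (c.contMDiffOn_point i).contMDiffAt
      (((c.isOpen_baseSet i).prod isOpen_univ).mem_nhds ⟨hp, mem_univ _⟩)
  exact ContMDiffAt.comp (g := c.point i)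
    (f := fun p => (p.proj, (c.vectorBundle.localTriv i p).2 + fun a => (k a : ℝ))) p h1
    ((contMDiffAt_fst.comp p h0).prodMk
      ((contMDiffAt_snd.comp p h0).add contMDiffAt_const))

theorem hasSmoothDeck_quot : HasSmoothDeck (totalModel n) c.quot := by
  intro p q h
  have hp := c.mem_baseSet_at p.proj
  obtain ⟨k, hk⟩ := c.exists_translate h _ hp
  refine ⟨c.translate (c.indexAt p.proj) k, c.contMDiffAt_translate _ k p hp, hk, ?_⟩
  filter_upwards [(c.isOpen_preimage_baseSet (c.indexAt p.proj)).mem_nhds hp] with p' h'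
  exact c.quot_translate _ k p' h'

instance torusChartedSpace :
    ChartedSpace (ModelProd (EuclideanSpace ℝ (Fin n)) (Fin n → ℝ)) c.Torus :=
  c.isLocalHomeomorph_quot.chartedSpace c.surjective_quot

instance torus_isManifold : IsManifold (totalModel n) ∞ c.Torus :=
  isManifold_chartedSpace c.isLocalHomeomorph_quot c.surjective_quot c.hasSmoothDeck_quot

theorem isLocalDiffeomorph_quot :
    IsLocalDiffeomorph (totalModel n) (totalModel n) ∞ c.quot :=
  isLocalDiffeomorph_of_deck c.isLocalHomeomorph_quot c.surjective_quot c.hasSmoothDeck_quot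

theorem isLocalDiffeomorphOn_param (i : ι) :
    IsLocalDiffeomorphOn (totalModel n) (totalModel n) ∞ (fun p => c.quot (c.point i p))
      (c.baseSet i ×ˢ univ) := by
  rintro ⟨p, hp⟩
  let e := c.vectorBundle.localTriv i
  let Φ : PartialDiffeomorph (totalModel n) (totalModel n) (M × (Fin n → ℝ)) c.VTotal ∞ :=
    { toPartialEquiv := e.toPartialEquiv.symm
      open_source := e.open_target
      open_target := e.open_source
      contMDiffOn_toFun := c.contMDiffOn_point i
      contMDiffOn_invFun := Trivialization.contMDiffOn (IB := 𝓡 n) e }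
  have h1 : p ∈ Φ.source := (e.mem_target).2 hp.1
  have h2 : IsLocalDiffeomorphAt (totalModel n) (totalModel n) ∞ (c.point i) p :=
    PartialDiffeomorph.isLocalDiffeomorphAt (φ := Φ) (hx := h1)
  exact h2.comp (hg := c.isLocalDiffeomorph_quot _)
end Smooth

end LatticeCocycle
end Cocycle

section TorusBundle
open LatticeCocycle

variable {ι M : Type*} {n : ℕ} [TopologicalSpace M] [ChartedSpace (EuclideanSpace ℝ (Fin n)) M]
  [IsManifold (𝓡 n) ∞ M] {c : LatticeCocycle ι M n}
  {Z : Type*} [TopologicalSpace Z]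
  [ChartedSpace (ModelProd (EuclideanSpace ℝ (Fin n)) (Fin n → ℝ)) Z]
  [IsManifold (totalModel n) ∞ Z]

/-- A smooth bundle `p : Z → M` of tori `𝕋 = ℝⁿ / ℤⁿ` over the `n`-manifold `M`, with structure group
`GL(n, ℤ) = Aut(𝕋)` and transition functions `c` (so a bundle of Lie groups, with a zero section).
A smooth local trivialization `p⁻¹(U i) ≃ U i × 𝕋` is given through its inverse precomposed with the
covering `U i × ℝⁿ → U i × 𝕋`; this composite is `param i`, a local diffeomorphism whose fibres
are the `ℤⁿ`-cosets. -/
structure TorusBundle (c : LatticeCocycle ι M n) (Z : Type*) [TopologicalSpace Z]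
    [ChartedSpace (ModelProd (EuclideanSpace ℝ (Fin n)) (Fin n → ℝ)) Z]
    [IsManifold (totalModel n) ∞ Z] where
  proj : Z → M
  param : ι → M × (Fin n → ℝ) → Z
  isLocalDiffeomorphOn_param : ∀ i,
    IsLocalDiffeomorphOn (totalModel n) (totalModel n) ∞ (param i) (c.baseSet i ×ˢ univ)
  proj_param : ∀ i, ∀ x ∈ c.baseSet i, ∀ v, proj (param i (x, v)) = x
  param_surjective : ∀ i z, proj z ∈ c.baseSet i → ∃ v, param i (proj z, v) = z
  param_eq_iff : ∀ i, ∀ x ∈ c.baseSet i, ∀ v w, param i (x, v) = param i (x, w) ↔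
    ∃ k : Fin n → ℤ, v = w + fun a => (k a : ℝ)
  param_transition : ∀ i j, ∀ x ∈ c.baseSet i ∩ c.baseSet j, ∀ v,
    param j (x, realAction (c.transition i j x) v) = param i (x, v)

/-- The quotient `tot(V) / Λ` is a torus bundle with transition functions `c`. -/
def LatticeCocycle.torusBundle (c : LatticeCocycle ι M n) : TorusBundle c c.Torus where
  proj := c.torusProj
  param i p := c.quot (c.point i p)
  isLocalDiffeomorphOn_param := c.isLocalDiffeomorphOn_param
  proj_param _ _ _ _ := rfl
  param_surjective i z := by
    refine Quotient.inductionOn z fun p hp => ?_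
    obtain ⟨v, hv⟩ := c.exists_point i p hp
    exact ⟨v, congrArg c.quot hv⟩
  param_eq_iff i x hx v w := c.quot_point_eq_iff i x hx v w
  param_transition i j x hx v := congrArg c.quot (c.point_transition i j x hx.1 hx.2 v)

namespace TorusBundle

/-- The dual torus bundle `Ẑ = tot(V^∨) / Λ^∨ → M`, where `V = s^* T_{Z/M}` for the zero section `s`
of `Z`, and `Λ^∨ ⊆ V^∨` is the lattice dual to the lattice `Λ ⊆ V` with `Z = tot(V) / Λ`. -/
def dual (_P : TorusBundle c Z) : TorusBundle c.dual c.dual.Torus := c.dual.torusBundle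

/-- The point of `Z` over `x` with coordinates `v` in the trivialization of index `c.indexAt x`. -/
def pointAt (P : TorusBundle c Z) (x : M) (v : Fin n → ℝ) : Z := P.param (c.indexAt x) (x, v)

/-- The splitting `(j, α) : V_x ⊕ T_x M ≃ T_z Z` at the point `z` over `x`, given by the natural flat
connection: `j` is the inclusion of the vertical vectors, and `α` is the horizontal lift, tangent to
the sections of `Z` that are constant in the local trivializations. Its inverse is `(D, dp)`. -/
def splitting (P : TorusBundle c Z) (x : M) (v : Fin n → ℝ) :
    (c.V x × TangentSpace (𝓡 n) x) ≃L[ℝ] TangentSpace (totalModel n) (P.pointAt x v) :=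
  (ContinuousLinearEquiv.prodComm ℝ (c.V x) (TangentSpace (𝓡 n) x)).trans
    ((P.isLocalDiffeomorphOn_param (c.indexAt x)
      ⟨(x, v), c.mem_baseSet_at x, mem_univ v⟩).mfderivToContinuousLinearEquiv (by simp))

end TorusBundle

/-- `A ⊕ A^∨` inside `(A ⊕ B) ⊕ (A ⊕ B)^∨`. -/
def leftPart (A B : Type*) [AddCommGroup A] [Module ℝ A] [TopologicalSpace A]
    [AddCommGroup B] [Module ℝ B] [TopologicalSpace B] : Set (GenSpace (A × B)) :=
  {a | a.1.2 = 0 ∧ ∀ y : B, a.2 (0, y) = 0}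

/-- `B ⊕ B^∨` inside `(A ⊕ B) ⊕ (A ⊕ B)^∨`. -/
def rightPart (A B : Type*) [AddCommGroup A] [Module ℝ A] [TopologicalSpace A]
    [AddCommGroup B] [Module ℝ B] [TopologicalSpace B] : Set (GenSpace (A × B)) :=
  {a | a.1.1 = 0 ∧ ∀ x : A, a.2 (x, 0) = 0}

/-- Fields of endomorphisms of the bundle `(V ⊕ T_M) ⊕ (V ⊕ T_M)^∨` on `M`. -/
abbrev BaseField (c : LatticeCocycle ι M n) : Type _ :=
  ∀ x : M, GenSpace (c.V x × TangentSpace (𝓡 n) x) →ₗ[ℝ] GenSpace (c.V x × TangentSpace (𝓡 n) x)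

/-- Adapted generalized almost complex structures on the vector bundle `V ⊕ T_M`:
those that exchange `V ⊕ V^∨` and `T_M ⊕ T_M^∨`. -/
structure BaseField.IsAdapted (K : BaseField c) : Prop where
  isGenComplex : ∀ x, IsGenComplex (K x)
  image_eq : ∀ x, K x '' leftPart (c.V x) (TangentSpace (𝓡 n) x) =
    rightPart (c.V x) (TangentSpace (𝓡 n) x)

/-- The duality `ℝⁿ ⊕ T ⊕ (ℝⁿ)^∨ ⊕ T^∨ ≃ (ℝⁿ)^∨ ⊕ T ⊕ ℝⁿ ⊕ T^∨` that exchanges `ℝⁿ` and its dual, where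
functionals on `ℝⁿ` are written as vectors through the dot product. -/
def shuffle (n : ℕ) (T : Type*) [AddCommGroup T] [Module ℝ T] [TopologicalSpace T] :
    GenSpace ((Fin n → ℝ) × T) →ₗ[ℝ] GenSpace ((Fin n → ℝ) × T) where
  toFun a := ((fun k => a.2 (Pi.single k 1, 0), a.1.2),
    (∑ k, a.1.1 k • (ContinuousLinearMap.proj k).comp (ContinuousLinearMap.fst ℝ (Fin n → ℝ) T)) +
      a.2.comp ((ContinuousLinearMap.inr ℝ (Fin n → ℝ) T).comp
        (ContinuousLinearMap.snd ℝ (Fin n → ℝ) T)))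
  map_add' a b := by
    ext <;> simp [add_mul, Finset.sum_add_distrib]; ring
  map_smul' r a := by
    ext <;> simp [Finset.mul_sum, mul_assoc]

theorem shuffle_shuffle (n : ℕ) (T : Type*) [AddCommGroup T] [Module ℝ T] [TopologicalSpace T]
    (a : GenSpace ((Fin n → ℝ) × T)) : shuffle n T (shuffle n T a) = a := by
  obtain ⟨⟨v, t⟩, f⟩ := a
  refine Prod.ext (Prod.ext ?_ rfl) (ContinuousLinearMap.ext ?_)
  · funext k
    have h0 : f (0, 0) = 0 := map_zero f
    simp [shuffle, Pi.single_apply, h0]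
  · rintro ⟨w, u⟩
    have h : f (w, u) = f (w, 0) + f (0, u) := by rw [← map_add]; simp
    have h2 : f (w, 0) = ∑ k, w k * f (Pi.single k 1, 0) := by
      have := (f.comp (ContinuousLinearMap.inl ℝ (Fin n → ℝ) T)).toLinearMap.pi_apply_eq_sum_univ w
      have h3 : ∀ k : Fin n, (fun j => if k = j then (1 : ℝ) else 0) = Pi.single k 1 := by
        intro k
        funext j
        simp [Pi.single_apply, eq_comm]
      simpa [h3] using this
    rw [h, h2]
    simp [shuffle, mul_comm]

/-- The endomorphism field of `(V^∨ ⊕ T_M) ⊕ (V^∨ ⊕ T_M)^∨` corresponding to one of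
`(V ⊕ T_M) ⊕ (V ⊕ T_M)^∨` under the identification
`V ⊕ T_M ⊕ V^∨ ⊕ T_M^∨ = V^∨ ⊕ T_M ⊕ V ⊕ T_M^∨` (an involution in coordinates, equal to its own inverse). -/
def BaseField.mirror (K : BaseField c) : BaseField c.dual := fun x =>
  shuffle n (TangentSpace (𝓡 n) x) ∘ₗ K x ∘ₗ shuffle n (TangentSpace (𝓡 n) x)

namespace TorusBundle

/-- `J = F⁻¹ (p^* K) F` on all of `Z`, where
`F : T_Z ⊕ T_Z^∨ → p^* (V ⊕ T_M ⊕ V^∨ ⊕ T_M^∨)` is given by the splitting of `T_Z`. -/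
def IsLift (P : TorusBundle c Z) (K : BaseField c)
    (J : GenAlmostComplexStructure (totalModel n) Z) : Prop :=
  ∀ x v, J.toFun (P.pointAt x v) =
    (genMap (P.splitting x v)).toLinearMap ∘ₗ K x ∘ₗ (genMap (P.splitting x v)).symm.toLinearMap

/-- Semi-flat generalized almost complex structures on `Z`. As `J` is smooth and `F` is a smooth
isomorphism of bundles, `K` is smooth as well. -/
def IsSemiFlat (P : TorusBundle c Z) (J : GenAlmostComplexStructure (totalModel n) Z) : Prop :=
  ∃ K : BaseField c, K.IsAdapted ∧ P.IsLift K J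

/-- `J` is semi-flat, coming from `K`, and `J'` is its mirror structure on the dual torus bundle,
coming from the mirror of `K`. -/
def IsMirror (P : TorusBundle c Z) (J : GenAlmostComplexStructure (totalModel n) Z)
    (J' : GenAlmostComplexStructure (totalModel n) c.dual.Torus) : Prop :=
  ∃ K : BaseField c, K.IsAdapted ∧ P.IsLift K J ∧ P.dual.IsLift K.mirror J'

end TorusBundle
end TorusBundle

end SemiFlat

end

set_option linter.unusedSectionVars false

noncomputable section

namespace SemiFlat

/-! ### The Courant bracket on a vector space -/

section Flat
variable {E : Type*} [NormedAddCommGroup E] [NormedSpace ℝ E]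

/-! In flat coordinates everything happens on a product `A × B` of base and fibre directions. There
a semi-flat structure is a field `T` of endomorphisms that is constant along `B`, because the
transition matrices are locally constant, and its mirror is `S T S`, where `S` is the constant
involution exchanging the fibre directions with their duals. Two facts about such fields carry the
theorem.

First, integrability of a field constant along `B` need only be tested on sections constant along
`B`. For fixed values of the sections the bracket is linear in their first derivatives, so it splits
into a horizontal and a vertical contribution. Vertical derivatives of eigensections stay in the
eigenspace, since `T` does not vary vertically. The eigenspace is isotropic, so the one-form terms
built from these derivatives vanish, and the vertical contribution is a combination of eigenvectors
(`inEigenspace_jetBracket`, `flatIntegrable_of_invIntegrable`).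

Second, the bracket of sections constant along `B` involves only the horizontal components of
vectors, the canonical pairing, and one-forms pulled back from `A`. The involution `S` preserves all
three, hence commutes with this bracket (`IsHorizontalIsometry.invBracket`). Together the two facts
give `FlatIntegrable.conj`.

The passage to manifolds rests on the naturality of the Courant bracket under local diffeomorphisms
(`pull_courantBracket`) and on the computation of the splitting in flat coordinates
(`mfderiv_localParam`). The mirror field descends to the dual torus bundle because the splitting is
invariant under the lattice (`splitting_eq`), and it is smooth because `S` is constant. Uniqueness
holds because a semi-flat structure and its field on the base determine each other; since the
exchange is an involution, the construction can be reversed. -/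

/-- The functional `⟨·, p⟩` on `E ⊕ E^∨`. -/
def pairingCLM (p : GenSpace E) : GenSpace E →L[ℝ] ℝ where
  toFun q := pairing q p
  map_add' a b := by simp [pairing]; ring
  map_smul' r a := by simp [pairing]; ring
  cont := by unfold pairing; fun_prop

theorem pairingCLM_apply (p q : GenSpace E) : pairingCLM p q = pairing q p := rfl

theorem pairing_neg_right (p q : GenSpace E) : pairing p (-q) = -pairing p q := by
  simp [pairing]; ring

theorem pairing_neg_left (p q : GenSpace E) : pairing (-p) q = -pairing p q := by
  simp [pairing]; ring

/-- The value of the Courant bracket on the vector space `E` of sections with values `p`, `q` and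
derivatives `P`, `Q`. -/
def jetBracket (p : GenSpace E) (P : E →L[ℝ] GenSpace E) (q : GenSpace E) (Q : E →L[ℝ] GenSpace E) :
    GenSpace E :=
  Q p.1 - P q.1 + (0, (pairingCLM p).comp Q - (pairingCLM q).comp P)

/-- The Courant bracket on the vector space `E`. -/
def flatBracket (a b : E → GenSpace E) (y : E) : GenSpace E :=
  jetBracket (a y) (fderiv ℝ a y) (b y) (fderiv ℝ b y)

theorem flatBracket_congr {a a₁ b b₁ : E → GenSpace E} {y : E} (ha : a =ᶠ[𝓝 y] a₁)
    (hb : b =ᶠ[𝓝 y] b₁) : flatBracket a b y = flatBracket a₁ b₁ y := by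
  rw [flatBracket, flatBracket, ha.fderiv_eq, hb.fderiv_eq, ha.eq_of_nhds, hb.eq_of_nhds]

/-- Integrability on `Ω ⊆ E` of a field of endomorphisms of `E ⊕ E^∨`. -/
def FlatIntegrable (T : E → GenSpace E →ₗ[ℝ] GenSpace E) (Ω : Set E) : Prop :=
  ∀ U ⊆ Ω, IsOpen U → ∀ a a' b b' : E → GenSpace E,
    ContDiffOn ℝ ∞ a U → ContDiffOn ℝ ∞ a' U → ContDiffOn ℝ ∞ b U → ContDiffOn ℝ ∞ b' U →
    (∀ y ∈ U, InEigenspace (T y) (a y) (a' y)) → (∀ y ∈ U, InEigenspace (T y) (b y) (b' y)) →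
    ∀ y ∈ U, InEigenspace (T y) (flatBracket a b y - flatBracket a' b' y)
      (flatBracket a b' y + flatBracket a' b y)

/-- Smoothness on `Ω ⊆ E` of a field of endomorphisms of `E ⊕ E^∨`. -/
def FlatSmooth (T : E → GenSpace E →ₗ[ℝ] GenSpace E) (Ω : Set E) : Prop :=
  ∀ U ⊆ Ω, IsOpen U → ∀ a : E → GenSpace E, ContDiffOn ℝ ∞ a U → ContDiffOn ℝ ∞ (fun y => T y (a y)) U

namespace InEigenspace
variable {J : GenSpace E →ₗ[ℝ] GenSpace E} {a a' b b' : GenSpace E}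

theorem add (ha : InEigenspace J a a') (hb : InEigenspace J b b') :
    InEigenspace J (a + b) (a' + b') :=
  ⟨by rw [map_add, ha.1, hb.1]; abel, by rw [map_add, ha.2, hb.2]⟩

theorem neg (ha : InEigenspace J a a') : InEigenspace J (-a) (-a') :=
  ⟨by rw [map_neg, ha.1], by rw [map_neg, ha.2]⟩

/-- The eigenspace is a complex subspace: `i (a + i a') = -a' + i a`. -/
theorem mul_I (ha : InEigenspace J a a') : InEigenspace J (-a') a :=
  ⟨by rw [map_neg, ha.2], by rw [ha.1]⟩

/-- The eigenspace is isotropic: on it `⟨a, b⟩ = ⟨J a, J b⟩ = ⟨i a, i b⟩ = -⟨a, b⟩`. Here and in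
`pairing_im` the real and the imaginary part of this identity are recorded. -/
theorem pairing_re (hJ : ∀ a b, pairing (J a) (J b) = pairing a b) (ha : InEigenspace J a a')
    (hb : InEigenspace J b b') : pairing a b - pairing a' b' = 0 := by
  rw [← hJ a b, ha.1, hb.1, pairing_neg_left, pairing_neg_right]; ring

theorem pairing_im (hJ : ∀ a b, pairing (J a) (J b) = pairing a b) (ha : InEigenspace J a a')
    (hb : InEigenspace J b b') : pairing a b' + pairing a' b = 0 := by
  rw [← hJ a b', ha.1, hb.2, pairing_neg_left]; ring

end InEigenspace

/-- This is what separates the base and the fibre derivatives: with the values `p`, `q` held fixed,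
the bracket is linear in the pair of derivatives. -/
theorem jetBracket_add (p : GenSpace E) (P R : E →L[ℝ] GenSpace E) (q : GenSpace E)
    (Q R' : E →L[ℝ] GenSpace E) :
    jetBracket p (P + R) q (Q + R') = jetBracket p P q Q + jetBracket p R q R' := by
  have h : ((0 : E), (pairingCLM p).comp (Q + R') - (pairingCLM q).comp (P + R)) =
      (0, (pairingCLM p).comp Q - (pairingCLM q).comp P) +
        (0, (pairingCLM p).comp R' - (pairingCLM q).comp R) := by
    rw [Prod.mk_add_mk, ContinuousLinearMap.comp_add, ContinuousLinearMap.comp_add, add_zero,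
      add_sub_add_comm]
  simp only [jetBracket, h, add_apply]
  abel

/-- If the derivatives of two eigensections take values in the eigenspace, then so does the Courant
bracket. -/
theorem inEigenspace_jetBracket {J : GenSpace E →ₗ[ℝ] GenSpace E}
    (hJ : ∀ a b, pairing (J a) (J b) = pairing a b) {p p' q q' : GenSpace E}
    {P P' Q Q' : E →L[ℝ] GenSpace E} (hp : InEigenspace J p p') (hq : InEigenspace J q q')
    (hP : ∀ w, InEigenspace J (P w) (P' w)) (hQ : ∀ w, InEigenspace J (Q w) (Q' w)) :
    InEigenspace J (jetBracket p P q Q - jetBracket p' P' q' Q')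
      (jetBracket p P q' Q' + jetBracket p' P' q Q) := by
  -- The directional derivatives `(Q + i Q')(p + i p')` and `(P + i P')(q + i q')`, expanded into
  -- complex combinations of eigenvectors; only the vector components of the arguments enter.
  have h := (((hQ p.1).add (hQ p'.1).mul_I).add ((hP q.1).add (hP q'.1).mul_I).neg)
  have e1 : jetBracket p P q Q - jetBracket p' P' q' Q' =
      Q p.1 + -Q' p'.1 + -(P q.1 + -P' q'.1) := by
    -- The real part of the one-form `w ↦ ⟨Q w, p⟩ - ⟨P w, q⟩`, which pairs eigenvectors with
    -- eigenvectors and so vanishes by isotropy; the imaginary part is treated in the same way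
    -- below.
    have : ((pairingCLM p).comp Q - (pairingCLM q).comp P) -
        ((pairingCLM p').comp Q' - (pairingCLM q').comp P') = 0 := by
      ext w
      have h1 := (hQ w).pairing_re hJ hp
      have h2 := (hP w).pairing_re hJ hq
      simp only [sub_apply, ContinuousLinearMap.comp_apply, pairingCLM_apply,
        zero_apply]
      linarith
    rw [jetBracket, jetBracket, sub_eq_zero.1 this]
    abel
  have e2 : jetBracket p P q' Q' + jetBracket p' P' q Q =
      Q' p.1 + Q p'.1 + -(P' q.1 + P q'.1) := by
    have : ((pairingCLM p).comp Q' - (pairingCLM q').comp P) +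
        ((pairingCLM p').comp Q - (pairingCLM q).comp P') = 0 := by
      ext w
      have h1 := (hQ w).pairing_im hJ hp
      have h2 := (hP w).pairing_im hJ hq
      simp only [sub_apply, add_apply,
        ContinuousLinearMap.comp_apply, pairingCLM_apply, zero_apply]
      linarith
    have h0 : ∀ θ : E →L[ℝ] ℝ, ((0 : E), -θ) = -(0, θ) := fun θ => by rw [Prod.neg_mk, neg_zero]
    rw [jetBracket, jetBracket, eq_neg_of_add_eq_zero_left this, h0]
    abel
  rw [e1, e2]
  exact h

end Flat

/-! ### Sections constant along the fibres -/

section Invariant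
variable {A B : Type*} [NormedAddCommGroup A] [NormedSpace ℝ A] [NormedAddCommGroup B]
  [NormedSpace ℝ B]

/-- The Courant bracket of sections over `A × B` that are constant along `B`. -/
def invBracket (a b : A → GenSpace (A × B)) (x : A) : GenSpace (A × B) :=
  jetBracket (a x) ((fderiv ℝ a x).comp (ContinuousLinearMap.fst ℝ A B)) (b x)
    ((fderiv ℝ b x).comp (ContinuousLinearMap.fst ℝ A B))

/-- Integrability tested on sections over `A × B` that are constant along `B`. -/
def InvIntegrable (T : A → GenSpace (A × B) →ₗ[ℝ] GenSpace (A × B)) (W : Set A) : Prop :=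
  ∀ U ⊆ W, IsOpen U → ∀ a a' b b' : A → GenSpace (A × B),
    ContDiffOn ℝ ∞ a U → ContDiffOn ℝ ∞ a' U → ContDiffOn ℝ ∞ b U → ContDiffOn ℝ ∞ b' U →
    (∀ y ∈ U, InEigenspace (T y) (a y) (a' y)) → (∀ y ∈ U, InEigenspace (T y) (b y) (b' y)) →
    ∀ y ∈ U, InEigenspace (T y) (invBracket a b y - invBracket a' b' y)
      (invBracket a b' y + invBracket a' b y)

theorem flatBracket_comp_fst {a b : A → GenSpace (A × B)} {x : A} (ha : DifferentiableAt ℝ a x)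
    (hb : DifferentiableAt ℝ b x) (v : B) :
    flatBracket (fun y : A × B => a y.1) (fun y => b y.1) (x, v) = invBracket a b x := by
  have h : ∀ {f : A → GenSpace (A × B)}, DifferentiableAt ℝ f x →
      fderiv ℝ (fun y : A × B => f y.1) (x, v) =
        (fderiv ℝ f x).comp (ContinuousLinearMap.fst ℝ A B) := by
    intro f hf
    exact (HasFDerivAt.comp (x, v) (g := f) (f := Prod.fst) hf.hasFDerivAt hasFDerivAt_fst).fderiv
  rw [flatBracket, invBracket, h ha, h hb]

/-- Sections constant along `B` are particular sections over `A × B`, with bracket `invBracket`; the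
fibre point at which the test is evaluated is immaterial. -/
theorem invIntegrable_of_flatIntegrable {T : A → GenSpace (A × B) →ₗ[ℝ] GenSpace (A × B)} {W : Set A}
    (h : FlatIntegrable (fun y => T y.1) (W ×ˢ univ)) : InvIntegrable T W := by
  intro U hU hUo a a' b b' ha ha' hb hb' hae hbe x hx
  have hc : ∀ {f : A → GenSpace (A × B)}, ContDiffOn ℝ ∞ f U →
      ContDiffOn ℝ ∞ (fun y : A × B => f y.1) (U ×ˢ univ) := fun hf =>
    hf.comp contDiff_fst.contDiffOn fun y hy => hy.1
  have hd : ∀ {f : A → GenSpace (A × B)}, ContDiffOn ℝ ∞ f U → DifferentiableAt ℝ f x := fun hf =>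
    (hf.contDiffAt (hUo.mem_nhds hx)).differentiableAt (by simp)
  have := h (U ×ˢ univ) (prod_mono hU subset_rfl) (hUo.prod isOpen_univ) _ _ _ _ (hc ha) (hc ha')
    (hc hb) (hc hb') (fun y hy => hae y.1 hy.1) (fun y hy => hbe y.1 hy.1) (x, 0) ⟨hx, mem_univ _⟩
  rwa [flatBracket_comp_fst (hd ha) (hd hb), flatBracket_comp_fst (hd ha') (hd hb'),
    flatBracket_comp_fst (hd ha) (hd hb'), flatBracket_comp_fst (hd ha') (hd hb)] at this

/-- At a point `(x, v)`, an arbitrary section has the same value and horizontal derivative as its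
restriction to the slice through `v`, extended constantly along `B`. The hypothesis handles that
extension, and the remaining vertical derivatives take values in the eigenspace. -/
theorem flatIntegrable_of_invIntegrable [FiniteDimensional ℝ A] [FiniteDimensional ℝ B]
    {T : A → GenSpace (A × B) →ₗ[ℝ] GenSpace (A × B)} {W : Set A}
    (hT : ∀ x ∈ W, IsGenComplex (T x)) (h : InvIntegrable T W) :
    FlatIntegrable (fun y => T y.1) (W ×ˢ univ) := by
  rintro U hU hUo a a' b b' ha ha' hb hb' hae hbe ⟨x, v⟩ hx
  let i : A → A × B := fun x' => (x', v)
  have hUi : IsOpen (i ⁻¹' U) := hUo.preimage (by fun_prop)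
  have hc : ∀ {f : A × B → GenSpace (A × B)}, ContDiffOn ℝ ∞ f U → ContDiffOn ℝ ∞ (f ∘ i) (i ⁻¹' U) :=
    fun hf => hf.comp (by fun_prop) (mapsTo_preimage _ _)
  have hd : ∀ {f : A × B → GenSpace (A × B)}, ContDiffOn ℝ ∞ f U → DifferentiableAt ℝ f (x, v) :=
    fun hf => (hf.contDiffAt (hUo.mem_nhds hx)).differentiableAt (by simp)
  -- The vertical part of the derivative, extended by zero on horizontal vectors.
  let R : (A × B → GenSpace (A × B)) → A × B →L[ℝ] GenSpace (A × B) := fun f =>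
    ((fderiv ℝ f (x, v)).comp (ContinuousLinearMap.inr ℝ A B)).comp (ContinuousLinearMap.snd ℝ A B)
  have hsplit : ∀ {f : A × B → GenSpace (A × B)}, ContDiffOn ℝ ∞ f U → fderiv ℝ f (x, v) =
      (fderiv ℝ (f ∘ i) x).comp (ContinuousLinearMap.fst ℝ A B) + R f := by
    intro f hf
    have h1 : HasFDerivAt i (ContinuousLinearMap.inl ℝ A B) x := hasFDerivAt_prodMk_left x v
    rw [(HasFDerivAt.comp x (g := f) (hd hf).hasFDerivAt h1).fderiv]
    refine ContinuousLinearMap.ext fun w => ?_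
    simp only [R, add_apply, ContinuousLinearMap.comp_apply,
      ContinuousLinearMap.coe_fst', ContinuousLinearMap.coe_snd', ContinuousLinearMap.inl_apply,
      ContinuousLinearMap.inr_apply, ← map_add]
    simp
  have hR : ∀ {f f' : A × B → GenSpace (A × B)}, ContDiffOn ℝ ∞ f U → ContDiffOn ℝ ∞ f' U →
      (∀ y ∈ U, InEigenspace (T y.1) (f y) (f' y)) → ∀ w, InEigenspace (T x) (R f w) (R f' w) := by
    intro f f' hf hf' he w
    let j : B → A × B := fun v' => (x, v')
    have h1 : HasFDerivAt j (ContinuousLinearMap.inr ℝ A B) v := hasFDerivAt_prodMk_right x v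
    have hj : ∀ᶠ v' in 𝓝 v, j v' ∈ U := h1.continuousAt.eventually_mem (hUo.mem_nhds hx)
    have hf1 := HasFDerivAt.comp v (g := f) (hd hf).hasFDerivAt h1
    have hf1' := HasFDerivAt.comp v (g := f') (hd hf').hasFDerivAt h1
    -- Along the fibre over `x` the endomorphism is the fixed linear map `T x`, so differentiating
    -- the eigenvector equations there gives the same equations for the derivatives.
    let L := (T x).toContinuousLinearMap
    have k1 : L.comp ((fderiv ℝ f (x, v)).comp (ContinuousLinearMap.inr ℝ A B)) =
        -((fderiv ℝ f' (x, v)).comp (ContinuousLinearMap.inr ℝ A B)) := by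
      refine (L.hasFDerivAt.comp v hf1).unique (hf1'.neg.congr_of_eventuallyEq ?_)
      filter_upwards [hj] with v' hv'
      exact (he _ hv').1
    have k2 : L.comp ((fderiv ℝ f' (x, v)).comp (ContinuousLinearMap.inr ℝ A B)) =
        (fderiv ℝ f (x, v)).comp (ContinuousLinearMap.inr ℝ A B) := by
      refine (L.hasFDerivAt.comp v hf1').unique (hf1.congr_of_eventuallyEq ?_)
      filter_upwards [hj] with v' hv'
      exact (he _ hv').2
    exact ⟨DFunLike.congr_fun k1 w.2, DFunLike.congr_fun k2 w.2⟩
  have hfb : ∀ {f g : A × B → GenSpace (A × B)}, ContDiffOn ℝ ∞ f U → ContDiffOn ℝ ∞ g U →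
      flatBracket f g (x, v) = invBracket (f ∘ i) (g ∘ i) x +
        jetBracket (f (x, v)) (R f) (g (x, v)) (R g) := by
    intro f g hf hg
    rw [flatBracket, hsplit hf, hsplit hg, jetBracket_add]
    rfl
  have h1 := h (i ⁻¹' U) (fun x' hx' => (hU hx').1) hUi _ _ _ _ (hc ha) (hc ha') (hc hb) (hc hb')
    (fun x' hx' => hae _ hx') (fun x' hx' => hbe _ hx') x hx
  have h2 := inEigenspace_jetBracket (hT x (hU hx).1).orthogonal (hae _ hx) (hbe _ hx) (hR ha ha' hae)
    (hR hb hb' hbe)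
  have h3 := h1.add h2
  rw [hfb ha hb, hfb ha' hb', hfb ha hb', hfb ha' hb, add_sub_add_comm, add_add_add_comm]
  exact h3

/-- Isometries of `(A × B) ⊕ (A × B)^∨` that preserve `A`-components of vectors and one-forms pulled
back from `A`. -/
structure IsHorizontalIsometry (S : GenSpace (A × B) →L[ℝ] GenSpace (A × B)) : Prop where
  involutive : ∀ a, S (S a) = a
  orthogonal : ∀ a b, pairing (S a) (S b) = pairing a b
  fst : ∀ a, (S a).1.1 = a.1.1
  form : ∀ θ : A × B →L[ℝ] ℝ, (∀ v, θ (0, v) = 0) → S (0, θ) = (0, θ)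

/-- The differentiation directions are horizontal components, the one-form term is made of pairings,
and this term vanishes on vertical vectors. A constant `S` respects each of these ingredients. -/
theorem IsHorizontalIsometry.invBracket {S : GenSpace (A × B) →L[ℝ] GenSpace (A × B)}
    (hS : IsHorizontalIsometry S) {a b : A → GenSpace (A × B)} {x : A} (ha : DifferentiableAt ℝ a x)
    (hb : DifferentiableAt ℝ b x) :
    invBracket (fun x => S (a x)) (fun x => S (b x)) x = S (invBracket a b x) := by
  have hd : ∀ {f : A → GenSpace (A × B)}, DifferentiableAt ℝ f x →
      fderiv ℝ (fun x => S (f x)) x = S.comp (fderiv ℝ f x) := fun hf =>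
    (S.hasFDerivAt.comp x hf.hasFDerivAt).fderiv
  simp only [SemiFlat.invBracket, hd ha, hd hb, jetBracket, map_add, map_sub]
  congr 1
  · simp [hS.fst]
  · rw [hS.form]
    · refine Prod.ext rfl (ContinuousLinearMap.ext fun w => ?_)
      simp [pairingCLM_apply, hS.orthogonal]
    · intro v
      simp

theorem InvIntegrable.conj {S : GenSpace (A × B) →L[ℝ] GenSpace (A × B)} (hS : IsHorizontalIsometry S)
    {T T' : A → GenSpace (A × B) →ₗ[ℝ] GenSpace (A × B)} {W : Set A} (h : InvIntegrable T W)
    (hT : ∀ x ∈ W, ∀ a, T' x a = S (T x (S a))) : InvIntegrable T' W := by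
  intro U hU hUo a a' b b' ha ha' hb hb' hae hbe x hx
  have hc : ∀ {f : A → GenSpace (A × B)}, ContDiffOn ℝ ∞ f U → ContDiffOn ℝ ∞ (fun x => S (f x)) U :=
    fun hf => S.contDiff.comp_contDiffOn hf
  have hd : ∀ {f : A → GenSpace (A × B)}, ContDiffOn ℝ ∞ f U → DifferentiableAt ℝ f x := fun hf =>
    (hf.contDiffAt (hUo.mem_nhds hx)).differentiableAt (by simp)
  have he : ∀ {x}, x ∈ U → ∀ {p p'}, InEigenspace (T' x) p p' ↔ InEigenspace (T x) (S p) (S p') := by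
    intro x hx p p'
    have hinj : ∀ p q, S p = q ↔ p = S q := fun p q =>
      ⟨fun h => by rw [← h, hS.involutive], fun h => by rw [h, hS.involutive]⟩
    rw [InEigenspace, InEigenspace, hT x (hU hx), hT x (hU hx), hinj, hinj, map_neg]
  have := h U hU hUo _ _ _ _ (hc ha) (hc ha') (hc hb) (hc hb') (fun y hy => (he hy).1 (hae y hy))
    (fun y hy => (he hy).1 (hbe y hy)) x hx
  rw [he hx, map_sub, map_add]
  rwa [hS.invBracket (hd ha) (hd hb), hS.invBracket (hd ha') (hd hb'), hS.invBracket (hd ha) (hd hb'),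
    hS.invBracket (hd ha') (hd hb)] at this

/-- The isometry `S` does not commute with the full Courant bracket on `A × B` in general, so the
argument passes through sections constant along `B`. -/
theorem FlatIntegrable.conj [FiniteDimensional ℝ A] [FiniteDimensional ℝ B]
    {S : GenSpace (A × B) →L[ℝ] GenSpace (A × B)} (hS : IsHorizontalIsometry S)
    {T T' : A → GenSpace (A × B) →ₗ[ℝ] GenSpace (A × B)} {W : Set A}
    (h : FlatIntegrable (fun y => T y.1) (W ×ˢ univ)) (hT' : ∀ x ∈ W, IsGenComplex (T' x))
    (hT : ∀ x ∈ W, ∀ a, T' x a = S (T x (S a))) :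
    FlatIntegrable (fun y => T' y.1) (W ×ˢ univ) :=
  flatIntegrable_of_invIntegrable hT' ((invIntegrable_of_flatIntegrable h).conj hS hT)

theorem FlatSmooth.conj {E : Type*} [NormedAddCommGroup E] [NormedSpace ℝ E]
    (S : GenSpace E →L[ℝ] GenSpace E) {T T' : E → GenSpace E →ₗ[ℝ] GenSpace E} {Ω : Set E}
    (h : FlatSmooth T Ω) (hT : ∀ y ∈ Ω, ∀ a, T' y a = S (T y (S a))) : FlatSmooth T' Ω := by
  intro U hU hUo a ha
  have := S.contDiff.comp_contDiffOn (h U hU hUo _ (S.contDiff.comp_contDiffOn ha))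
  exact this.congr fun y hy => hT y (hU hy) _

end Invariant

/-! ### Pullback along linear isomorphisms -/

section Pull
variable {A B C : Type*} [AddCommGroup A] [Module ℝ A] [TopologicalSpace A]
  [AddCommGroup B] [Module ℝ B] [TopologicalSpace B] [AddCommGroup C] [Module ℝ C] [TopologicalSpace C]

/-- The pullback `B ⊕ B^∨ → A ⊕ A^∨` along a linear map `A → B`, meaningful for isomorphisms. -/
def pull (L : A →L[ℝ] B) (g : GenSpace B) : GenSpace A := (L.inverse g.1, g.2.comp L)

theorem pull_coe (e : A ≃L[ℝ] B) (g : GenSpace B) : pull (e : A →L[ℝ] B) g = (genMap e).symm g := by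
  rw [pull, ContinuousLinearMap.inverse_equiv]; rfl

theorem pull_comp (e : A ≃L[ℝ] B) (e' : B ≃L[ℝ] C) (g : GenSpace C) :
    pull ((e' : B →L[ℝ] C).comp (e : A →L[ℝ] B)) g = pull (e : A →L[ℝ] B) (pull (e' : B →L[ℝ] C) g) := by
  have : (e' : B →L[ℝ] C).comp (e : A →L[ℝ] B) = ((e.trans e' : A ≃L[ℝ] C) : A →L[ℝ] C) := rfl
  rw [this, pull_coe, pull_coe, pull_coe]
  rfl

end Pull

/-! ### Sections of `T_N ⊕ T_N^∨` in local parametrizations -/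

section Manifold
variable {E : Type*} [NormedAddCommGroup E] [NormedSpace ℝ E] [CompleteSpace E]
  {H : Type*} [TopologicalSpace H] {I : ModelWithCorners ℝ E H}
  {N : Type*} [TopologicalSpace N] [ChartedSpace H N]

/-- The pullback to `E` of a section of `T_N ⊕ T_N^∨`. -/
def pullbackSection (Φ : E → N) (a : GenSection I N) (y : E) : GenSpace E :=
  pull (A := TangentSpace 𝓘(ℝ, E) y) (mfderiv 𝓘(ℝ, E) I Φ y) (a (Φ y))

theorem pullbackSection_congr {Φ Ψ : E → N} {y : E} (h : Φ =ᶠ[𝓝 y] Ψ) (a : GenSection I N) :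
    pullbackSection Φ a =ᶠ[𝓝 y] pullbackSection Ψ a := by
  filter_upwards [h.eventuallyEq_nhds] with y' hy'
  have h1 := hy'.mfderiv_eq (I := 𝓘(ℝ, E)) (I' := I)
  have h2 := hy'.eq_of_nhds
  simp only [pullbackSection]
  -- The two derivatives live over points that are only propositionally equal, so they are
  -- generalized before the points are identified.
  revert h1
  generalize mfderiv 𝓘(ℝ, E) I Φ y' = L
  generalize mfderiv 𝓘(ℝ, E) I Ψ y' = L'
  revert L L'
  rw [h2]
  rintro L L' rfl
  rfl

theorem eventually_isLocalDiffeomorphAt {E' : Type*} [NormedAddCommGroup E'] [NormedSpace ℝ E']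
    {H' : Type*} [TopologicalSpace H'] {I' : ModelWithCorners ℝ E' H'}
    {N' : Type*} [TopologicalSpace N'] [ChartedSpace H' N'] {f : N → N'} {x : N}
    (h : IsLocalDiffeomorphAt I I' ∞ f x) : ∀ᶠ y in 𝓝 x, IsLocalDiffeomorphAt I I' ∞ f y := by
  obtain ⟨Φ, hx, he⟩ := h
  filter_upwards [Φ.open_source.mem_nhds hx] with y hy
  exact ⟨Φ, hy, he⟩

theorem pullbackSection_comp {Φ : E → N} {κ : E → E} {y : E}
    (hκ : IsLocalDiffeomorphAt 𝓘(ℝ, E) 𝓘(ℝ, E) ∞ κ y)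
    (hΦ : IsLocalDiffeomorphAt 𝓘(ℝ, E) I ∞ Φ (κ y)) (a : GenSection I N) :
    pullbackSection (Φ ∘ κ) a y = pull (fderiv ℝ κ y) (pullbackSection Φ a (κ y)) := by
  rw [pullbackSection, mfderiv_comp y (hΦ.mdifferentiableAt (by simp)) (hκ.mdifferentiableAt (by simp)),
    ← mfderiv_eq_fderiv]
  exact pull_comp (hκ.mfderivToContinuousLinearEquiv (by simp))
    (hΦ.mfderivToContinuousLinearEquiv (by simp)) _

theorem fderiv_isInvertible {κ : E → E} {y : E} (hκ : IsLocalDiffeomorphAt 𝓘(ℝ, E) 𝓘(ℝ, E) ∞ κ y) :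
    (fderiv ℝ κ y).IsInvertible := by
  rw [← mfderiv_eq_fderiv]
  exact ⟨hκ.mfderivToContinuousLinearEquiv (by simp), rfl⟩

/-- The vector part uses the inverse of the derivative, which varies smoothly because inversion of
operators is smooth at an invertible one. -/
theorem contDiffAt_pull {κ : E → E} {y : E} (hκ : IsLocalDiffeomorphAt 𝓘(ℝ, E) 𝓘(ℝ, E) ∞ κ y)
    {f : E → GenSpace E} (hf : ContDiffAt ℝ ∞ f (κ y)) :
    ContDiffAt ℝ ∞ (fun y' => pull (fderiv ℝ κ y') (f (κ y'))) y := by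
  have h0 : ContDiffAt ℝ ∞ κ y := hκ.contMDiffAt.contDiffAt
  have h1 : ContDiffAt ℝ ∞ (fderiv ℝ κ) y := h0.fderiv_right (by simp)
  have h2 : ContDiffAt ℝ ∞ (fun y' => f (κ y')) y := hf.comp y h0
  have h3 : ContDiffAt ℝ ∞ (fun y' => (fderiv ℝ κ y').inverse) y := by
    obtain ⟨e, he⟩ := fderiv_isInvertible hκ
    have := contDiffAt_map_inverse (𝕜 := ℝ) (n := ∞) e
    rw [he] at this
    exact this.comp y h1
  exact (h3.clm_apply (contDiff_fst.contDiffAt.comp y h2)).prodMk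
    ((contDiff_snd.contDiffAt.comp y h2).clm_comp h1)

/-- The transition between two local parametrizations of `N`. -/
theorem exists_transition {Φ Ψ : E → N} {y y' : E} (hΦ : IsLocalDiffeomorphAt 𝓘(ℝ, E) I ∞ Φ y)
    (hΨ : IsLocalDiffeomorphAt 𝓘(ℝ, E) I ∞ Ψ y') (h : Φ y = Ψ y') :
    ∃ κ : E → E, IsLocalDiffeomorphAt 𝓘(ℝ, E) 𝓘(ℝ, E) ∞ κ y ∧ κ y = y' ∧ Φ =ᶠ[𝓝 y] Ψ ∘ κ := by
  have hinv : IsLocalDiffeomorphAt I 𝓘(ℝ, E) ∞ hΨ.localInverse (Φ y) := by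
    rw [h]; exact hΨ.localInverse_isLocalDiffeomorphAt
  refine ⟨hΨ.localInverse ∘ Φ, hΦ.comp (hg := hinv), ?_, ?_⟩
  · rw [comp_apply, h]; exact hΨ.localInverse_left_inv hΨ.localInverse_mem_target
  · have : ∀ᶠ x in 𝓝 y, Φ x ∈ hΨ.localInverse.source :=
      hΦ.contMDiffAt.continuousAt.eventually_mem
        (h ▸ hΨ.localInverse_open_source.mem_nhds hΨ.localInverse_mem_source)
    filter_upwards [this] with x hx
    exact (hΨ.localInverse_right_inv hx).symm

theorem pullbackSection_eventuallyEq {Φ Ψ : E → N} {κ : E → E} {y : E}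
    (hκ : IsLocalDiffeomorphAt 𝓘(ℝ, E) 𝓘(ℝ, E) ∞ κ y)
    (hΨ : IsLocalDiffeomorphAt 𝓘(ℝ, E) I ∞ Ψ (κ y)) (h : Φ =ᶠ[𝓝 y] Ψ ∘ κ) (a : GenSection I N) :
    pullbackSection Φ a =ᶠ[𝓝 y] fun y' => pull (fderiv ℝ κ y') (pullbackSection Ψ a (κ y')) := by
  refine (pullbackSection_congr h a).trans ?_
  filter_upwards [eventually_isLocalDiffeomorphAt hκ,
    hκ.contMDiffAt.continuousAt.eventually (eventually_isLocalDiffeomorphAt hΨ)] with y' h1 h2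
  exact pullbackSection_comp h1 h2 a

theorem contDiffAt_pullbackSection_of_eq {Φ Ψ : E → N} {y y' : E}
    (hΦ : IsLocalDiffeomorphAt 𝓘(ℝ, E) I ∞ Φ y) (hΨ : IsLocalDiffeomorphAt 𝓘(ℝ, E) I ∞ Ψ y')
    (h : Φ y = Ψ y') {a : GenSection I N} (ha : ContDiffAt ℝ ∞ (pullbackSection Ψ a) y') :
    ContDiffAt ℝ ∞ (pullbackSection Φ a) y := by
  obtain ⟨κ, hκ, rfl, hκΦ⟩ := exists_transition hΦ hΨ h
  exact (contDiffAt_pull hκ ha).congr_of_eventuallyEq (pullbackSection_eventuallyEq hκ hΨ hκΦ a)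

variable [IsManifold I ∞ N]

/-- Smoothness at a point of a section of `T_N ⊕ T_N^∨`. -/
def IsSmoothAt (a : GenSection I N) (z : N) : Prop :=
  ContMDiffAt I I.tangent ∞ (fun z => (⟨z, (a z).1⟩ : TangentBundle I N)) z ∧
  ContMDiffAt I (I.prod 𝓘(ℝ, E →L[ℝ] ℝ)) ∞
    (fun z => (⟨z, (a z).2⟩ :
      TotalSpace (E →L[ℝ] ℝ) (fun y : N => TangentSpace I y →L[ℝ] Bundle.Trivial N ℝ y))) z

theorem isSmoothOn_iff {a : GenSection I N} {U : Set N} (hU : IsOpen U) :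
    IsSmoothOn a U ↔ ∀ z ∈ U, IsSmoothAt a z :=
  ⟨fun h _ hz => ⟨h.1.contMDiffAt (hU.mem_nhds hz), h.2.contMDiffAt (hU.mem_nhds hz)⟩,
    fun h => ⟨fun z hz => (h z hz).1.contMDiffWithinAt, fun z hz => (h z hz).2.contMDiffWithinAt⟩⟩

variable [I.Boundaryless]

/-- The inverse of the preferred chart at a point, as a partial diffeomorphism. -/
def chartDiffeomorph (z : N) : PartialDiffeomorph 𝓘(ℝ, E) I E N ∞ where
  toPartialEquiv := (extChartAt I z).symm
  open_source := isOpen_extChartAt_target z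
  open_target := isOpen_extChartAt_source z
  contMDiffOn_toFun := contMDiffOn_extChartAt_symm z
  contMDiffOn_invFun := by simpa using! contMDiffOn_extChartAt (I := I) (n := ∞) (x := z)

theorem isLocalDiffeomorphAt_extChartAt_symm (z : N) {w : E} (hw : w ∈ (extChartAt I z).target) :
    IsLocalDiffeomorphAt 𝓘(ℝ, E) I ∞ (extChartAt I z).symm w :=
  ⟨chartDiffeomorph z, hw, eqOn_refl _ _⟩

theorem isLocalDiffeomorphAt_extChartAt (z : N) :
    IsLocalDiffeomorphAt I 𝓘(ℝ, E) ∞ (extChartAt I z) z :=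
  ⟨(chartDiffeomorph z).symm, mem_extChartAt_source z, eqOn_refl _ _⟩

theorem contMDiffAt_iff_extChartAt_symm {F : Type*} [NormedAddCommGroup F] [NormedSpace ℝ F]
    {f : N → F} {z : N} : ContMDiffAt I 𝓘(ℝ, F) ∞ f z ↔
      ContDiffAt ℝ ∞ (f ∘ (extChartAt I z).symm) (extChartAt I z z) := by
  rw [contMDiffAt_iff_source, I.range_eq_univ, contMDiffWithinAt_univ, contMDiffAt_iff_contDiffAt]

theorem contDiffAt_congr_iff {F F' : Type*} [NormedAddCommGroup F] [NormedSpace ℝ F]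
    [NormedAddCommGroup F'] [NormedSpace ℝ F'] {f g : F → F'} {x : F} (h : f =ᶠ[𝓝 x] g) :
    ContDiffAt ℝ ∞ f x ↔ ContDiffAt ℝ ∞ g x :=
  ⟨fun hf => hf.congr_of_eventuallyEq h.symm, fun hg => hg.congr_of_eventuallyEq h⟩

/-- In the preferred chart at `z` the tangent trivialization is the derivative of the chart, which
is inverse to that of the chart inverse; the cotangent trivialization is composition with the
latter. These are the two components of the pullback. -/
theorem isSmoothAt_iff_chart {a : GenSection I N} {z : N} :
    IsSmoothAt a z ↔
      ContDiffAt ℝ ∞ (pullbackSection (extChartAt I z).symm a) (extChartAt I z z) := by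
  have htarget : ∀ᶠ w in 𝓝 (extChartAt I z z), w ∈ (extChartAt I z).target :=
    (isOpen_extChartAt_target z).mem_nhds (mem_extChartAt_target z)
  have h1 : ContMDiffAt I I.tangent ∞ (fun z => (⟨z, (a z).1⟩ : TangentBundle I N)) z ↔
      ContDiffAt ℝ ∞ (fun w => (pullbackSection (extChartAt I z).symm a w).1) (extChartAt I z z) := by
    rw [contMDiffAt_section, contMDiffAt_iff_extChartAt_symm]
    refine contDiffAt_congr_iff ?_
    filter_upwards [htarget] with w hw
    have hs : (extChartAt I z).symm w ∈ (chartAt H z).source := by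
      rw [← extChartAt_source I]; exact (extChartAt I z).map_target hw
    rw [comp_apply]
    have hc := TangentBundle.continuousLinearMapAt_trivializationAt (I := I) (𝕜 := ℝ) hs
    have h3 : ∀ v, (trivializationAt E (TangentSpace I) z ⟨(extChartAt I z).symm w, v⟩).2 =
        mfderiv I 𝓘(ℝ, E) (extChartAt I z) ((extChartAt I z).symm w) v := by
      intro v
      have hq : (trivializationAt E (TangentSpace I) z).continuousLinearMapAt ℝ
          ((extChartAt I z).symm w) v =
          (trivializationAt E (TangentSpace I) z ⟨(extChartAt I z).symm w, v⟩).2 := by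
        rw [Trivialization.continuousLinearMapAt_apply, Trivialization.coe_linearMapAt_of_mem]
        simpa using hs
      exact hq.symm.trans (DFunLike.congr_fun hc v)
    rw [h3]
    have k1 := mfderiv_extChartAt_comp_mfderivWithin_extChartAt_symm (I := I) hw
    have k2 := mfderivWithin_extChartAt_symm_comp_mfderiv_extChartAt (I := I) hw
    rw [I.range_eq_univ, mfderivWithin_univ] at k1 k2
    have k3 := ContinuousLinearMap.inverse_eq k2 k1
    exact (DFunLike.congr_fun k3 _).symm
  have h2 : ContMDiffAt I (I.prod 𝓘(ℝ, E →L[ℝ] ℝ)) ∞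
    (fun z => (⟨z, (a z).2⟩ :
      TotalSpace (E →L[ℝ] ℝ) (fun y : N => TangentSpace I y →L[ℝ] Bundle.Trivial N ℝ y))) z ↔
      ContDiffAt ℝ ∞ (fun w => (pullbackSection (extChartAt I z).symm a w).2) (extChartAt I z z) := by
    rw [contMDiffAt_section, contMDiffAt_iff_extChartAt_symm]
    refine contDiffAt_congr_iff ?_
    filter_upwards [htarget] with w hw
    have hs : (extChartAt I z).symm w ∈ (chartAt H z).source := by
      rw [← extChartAt_source I]; exact (extChartAt I z).map_target hw
    have hc := TangentBundle.symmL_trivializationAt (I := I) (𝕜 := ℝ) hs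
    rw [comp_apply, hom_trivializationAt_apply, ContinuousLinearMap.inCoordinates, hc]
    rw [I.range_eq_univ, mfderivWithin_univ, (extChartAt I z).right_inv hw]
    refine ContinuousLinearMap.ext fun u => ?_
    have ht : ∀ p r, (trivializationAt ℝ (Bundle.Trivial N ℝ) z).continuousLinearMapAt ℝ p r = r := by
      intro p r
      rw [Trivialization.continuousLinearMapAt_apply, Trivialization.coe_linearMapAt_of_mem]
      · rfl
      · exact mem_univ _
    exact ht _ _
  rw [IsSmoothAt, h1, h2]
  exact ⟨fun h => h.1.prodMk h.2, fun h => ⟨contDiff_fst.contDiffAt.comp _ h,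
    contDiff_snd.contDiffAt.comp _ h⟩⟩

/-- Smoothness may be read in any local parametrization, since two of them differ by a local
diffeomorphism of `E`, along which pullback preserves smoothness. -/
theorem isSmoothAt_iff {Φ : E → N} {y : E} (hΦ : IsLocalDiffeomorphAt 𝓘(ℝ, E) I ∞ Φ y)
    {a : GenSection I N} : IsSmoothAt a (Φ y) ↔ ContDiffAt ℝ ∞ (pullbackSection Φ a) y := by
  have h := isLocalDiffeomorphAt_extChartAt_symm (Φ y) (mem_extChartAt_target (I := I) (Φ y))
  have h0 : (extChartAt I (Φ y)).symm (extChartAt I (Φ y) (Φ y)) = Φ y := extChartAt_to_inv _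
  rw [isSmoothAt_iff_chart]
  exact ⟨contDiffAt_pullbackSection_of_eq hΦ h h0.symm, contDiffAt_pullbackSection_of_eq h hΦ h0⟩

end Manifold

/-! ### Naturality of the Courant bracket -/

section Naturality
variable {E : Type*} [NormedAddCommGroup E] [NormedSpace ℝ E] [CompleteSpace E]
  {H : Type*} [TopologicalSpace H] {I : ModelWithCorners ℝ E H} [I.Boundaryless]
  {N : Type*} [TopologicalSpace N] [ChartedSpace H N] [IsManifold I ∞ N]

theorem minSmoothness_two_le_infty : minSmoothness ℝ 2 ≤ ∞ := by
  rw [minSmoothness_of_isRCLikeNormedField]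
  exact WithTop.coe_le_coe.2 (le_top : (2 : ℕ∞) ≤ ⊤)

theorem mlieBracket_eq_lieBracket (V W : ∀ x : E, TangentSpace 𝓘(ℝ, E) x) :
    VectorField.mlieBracket 𝓘(ℝ, E) V W = VectorField.lieBracket ℝ V W := by
  rw [← VectorField.mlieBracketWithin_univ, VectorField.mlieBracketWithin_eq_lieBracketWithin]
  exact VectorField.lieBracketWithin_univ

/-- The exterior derivative commutes with pullbacks along local diffeomorphisms of `E`. -/
theorem fderiv_clm_comp_sub {κ : E → E} {y : E} (hκ : ContDiffAt ℝ ∞ κ y) {β : E → E →L[ℝ] ℝ}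
    (hβ : DifferentiableAt ℝ β (κ y)) (u w : E) :
    fderiv ℝ (fun y' => (β (κ y')).comp (fderiv ℝ κ y')) y u w -
      fderiv ℝ (fun y' => (β (κ y')).comp (fderiv ℝ κ y')) y w u =
    fderiv ℝ β (κ y) (fderiv ℝ κ y u) (fderiv ℝ κ y w) -
      fderiv ℝ β (κ y) (fderiv ℝ κ y w) (fderiv ℝ κ y u) := by
  have h1 : DifferentiableAt ℝ κ y := hκ.differentiableAt (by simp)
  have h2 : DifferentiableAt ℝ (fderiv ℝ κ) y :=
    (hκ.fderiv_right (m := ∞) (by simp)).differentiableAt (by simp)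
  have h3 := (HasFDerivAt.comp y (g := β) hβ.hasFDerivAt h1.hasFDerivAt).clm_comp h2.hasFDerivAt
  -- The second derivative of `κ` is symmetric, so it drops out of the antisymmetrized derivative.
  have hs : fderiv ℝ (fderiv ℝ κ) y u w = fderiv ℝ (fderiv ℝ κ) y w u :=
    (hκ.isSymmSndFDerivAt minSmoothness_two_le_infty) u w
  have h4 : fderiv ℝ (fun y' => (β (κ y')).comp (fderiv ℝ κ y')) y = _ := h3.fderiv
  rw [h4]
  simp [hs]

/-- The exterior derivative was defined through the preferred chart; the transition `κ` from `Φ` to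
that chart shows that any local parametrization gives the same value. -/
theorem interiorExtDeriv_apply {Φ : E → N} {y : E} (hΦ : IsLocalDiffeomorphAt 𝓘(ℝ, E) I ∞ Φ y)
    {a : GenSection I N} (ha : IsSmoothAt a (Φ y)) (u w : TangentSpace 𝓘(ℝ, E) y) :
    interiorExtDeriv (fun z => (a z).2) (Φ y) (mfderiv 𝓘(ℝ, E) I Φ y u) (mfderiv 𝓘(ℝ, E) I Φ y w) =
      fderiv ℝ (fun y' => (pullbackSection Φ a y').2) y u w -
        fderiv ℝ (fun y' => (pullbackSection Φ a y').2) y w u := by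
  set φ := extChartAt I (Φ y) with hφ
  let κ : E → E := φ ∘ Φ
  have hsymm : IsLocalDiffeomorphAt 𝓘(ℝ, E) I ∞ φ.symm (κ y) :=
    isLocalDiffeomorphAt_extChartAt_symm _ (mem_extChartAt_target _)
  have hφ' : IsLocalDiffeomorphAt I 𝓘(ℝ, E) ∞ φ (Φ y) := isLocalDiffeomorphAt_extChartAt _
  have hκ : IsLocalDiffeomorphAt 𝓘(ℝ, E) 𝓘(ℝ, E) ∞ κ y := hΦ.comp (hg := hφ')
  have hΦκ : Φ =ᶠ[𝓝 y] φ.symm ∘ κ := by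
    filter_upwards [hΦ.contMDiffAt.continuousAt.eventually_mem
      (extChartAt_source_mem_nhds (I := I) (Φ y))] with y' hy'
    exact (φ.left_inv hy').symm
  let β : E → E →L[ℝ] ℝ := fun w => (pullbackSection φ.symm a w).2
  have hβ : ContDiffAt ℝ ∞ β (κ y) :=
    contDiff_snd.contDiffAt.comp _ (isSmoothAt_iff_chart.1 ha)
  have hpb : (fun y' => (pullbackSection Φ a y').2) =ᶠ[𝓝 y]
      fun y' => (β (κ y')).comp (fderiv ℝ κ y') := by
    filter_upwards [pullbackSection_eventuallyEq hκ hsymm hΦκ a] with y' hy'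
    rw [hy']
    rfl
  rw [hpb.fderiv_eq]
  refine Eq.trans ?_ (fderiv_clm_comp_sub hκ.contMDiffAt.contDiffAt
    (hβ.differentiableAt (by simp)) u w).symm
  have hA : ∀ v, mfderiv I 𝓘(ℝ, E) φ (Φ y) (mfderiv 𝓘(ℝ, E) I Φ y v) = fderiv ℝ κ y v := by
    intro v
    rw [← mfderiv_eq_fderiv, mfderiv_comp y (hφ'.mdifferentiableAt (by simp))
      (hΦ.mdifferentiableAt (by simp))]
    rfl
  have hD : interiorExtDeriv (fun z => (a z).2) (Φ y) = fun u =>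
      ((fderiv ℝ β (κ y) (mfderiv I 𝓘(ℝ, E) φ (Φ y) u) -
        (fderiv ℝ β (κ y)).flip (mfderiv I 𝓘(ℝ, E) φ (Φ y) u)).comp
          (mfderiv I 𝓘(ℝ, E) φ (Φ y)) : TangentSpace I (Φ y) →L[ℝ] ℝ) := by
    funext u
    simp only [interiorExtDeriv, I.range_eq_univ, mfderivWithin_univ, fderivWithin_univ]
    rfl
  rw [hD, ← hA, ← hA]
  rfl

/-- Differentiability of `f` is recovered from that of `g` by composing with a local inverse of `Φ`;
the formula is then the chain rule. -/
theorem differential_apply {Φ : E → N} {y : E} (hΦ : IsLocalDiffeomorphAt 𝓘(ℝ, E) I ∞ Φ y)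
    {f : N → ℝ} {g : E → ℝ} (hfg : f ∘ Φ =ᶠ[𝓝 y] g) (hg : DifferentiableAt ℝ g y)
    (w : TangentSpace 𝓘(ℝ, E) y) :
    differential f (Φ y) (mfderiv 𝓘(ℝ, E) I Φ y w) = fderiv ℝ g y w := by
  have h1 : f =ᶠ[𝓝 (Φ y)] g ∘ hΦ.localInverse := by
    have h2 : hΦ.localInverse (Φ y) = y := hΦ.localInverse_left_inv hΦ.localInverse_mem_target
    have h3 : ∀ᶠ z in 𝓝 (Φ y), (f ∘ Φ) (hΦ.localInverse z) = g (hΦ.localInverse z) := by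
      have h4 : ∀ᶠ x in 𝓝 (hΦ.localInverse (Φ y)), (f ∘ Φ) x = g x := by rw [h2]; exact hfg
      exact hΦ.localInverse_contMDiffAt.continuousAt.eventually h4
    filter_upwards [h3, hΦ.localInverse_eventuallyEq_right] with z hz hz'
    rw [comp_apply, ← hz, comp_apply]
    exact (congrArg f hz').symm
  have hf : MDifferentiableAt I 𝓘(ℝ, ℝ) f (Φ y) := by
    refine MDifferentiableAt.congr_of_eventuallyEq ?_ h1
    refine MDifferentiableAt.comp _ ?_ (hΦ.localInverse_mdifferentiableAt (by simp))
    rw [hΦ.localInverse_left_inv hΦ.localInverse_mem_target]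
    exact hg.mdifferentiableAt
  rw [← hfg.fderiv_eq, ← mfderiv_eq_fderiv, mfderiv_comp y hf (hΦ.mdifferentiableAt (by simp))]
  rfl

/-- The Courant bracket commutes with local diffeomorphisms. -/
theorem pull_courantBracket {Φ : E → N} {y : E} (hΦ : IsLocalDiffeomorphAt 𝓘(ℝ, E) I ∞ Φ y)
    {a b : GenSection I N} (ha : IsSmoothAt a (Φ y)) (hb : IsSmoothAt b (Φ y)) :
    pullbackSection Φ (courantBracket a b) y =
      flatBracket (pullbackSection Φ a) (pullbackSection Φ b) y := by
  have hda := ((isSmoothAt_iff hΦ).1 ha).differentiableAt (by simp)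
  have hdb := ((isSmoothAt_iff hΦ).1 hb).differentiableAt (by simp)
  have h1 : ∀ {f : E → GenSpace E}, DifferentiableAt ℝ f y →
      HasFDerivAt (fun y' => (f y').1) ((ContinuousLinearMap.fst ℝ _ _).comp (fderiv ℝ f y)) y :=
    fun hf => hf.hasFDerivAt.fst
  have h2 : ∀ {f : E → GenSpace E}, DifferentiableAt ℝ f y →
      HasFDerivAt (fun y' => (f y').2) ((ContinuousLinearMap.snd ℝ _ _).comp (fderiv ℝ f y)) y :=
    fun hf => hf.hasFDerivAt.snd
  have hinv : ∀ᶠ y' in 𝓝 y, ∀ v, mfderiv 𝓘(ℝ, E) I Φ y' ((mfderiv 𝓘(ℝ, E) I Φ y').inverse v) = v := by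
    filter_upwards [eventually_isLocalDiffeomorphAt hΦ] with y' hy' v
    have he : mfderiv 𝓘(ℝ, E) I Φ y' = hy'.mfderivToContinuousLinearEquiv (by simp) := rfl
    rw [he, ContinuousLinearMap.inverse_equiv]
    exact ContinuousLinearEquiv.apply_symm_apply _ _
  have hc : ∀ (f g : GenSection I N), (fun z => (f z).2 (g z).1) ∘ Φ =ᶠ[𝓝 y]
      fun y' => (pullbackSection Φ f y').2 (pullbackSection Φ g y').1 := by
    intro f g
    filter_upwards [hinv] with y' hy'
    exact (congrArg ((f (Φ y')).2) (hy' _)).symm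
  have hX : ∀ (f : GenSection I N), (f (Φ y)).1 =
      mfderiv 𝓘(ℝ, E) I Φ y (pullbackSection Φ f y).1 := fun f => (hinv.self_of_nhds _).symm
  have hcd : ∀ {f g : E → GenSpace E}, DifferentiableAt ℝ f y → DifferentiableAt ℝ g y → ∀ w,
      DifferentiableAt ℝ (fun y' => (f y').2 (g y').1) y ∧
      fderiv ℝ (fun y' => (f y').2 (g y').1) y w =
        (fderiv ℝ f y w).2 (g y).1 + (f y).2 (fderiv ℝ g y w).1 := by
    intro f g hf hg w
    have := (h2 hf).clm_apply (h1 hg)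
    refine ⟨this.differentiableAt, ?_⟩
    rw [this.fderiv]
    simp [add_comm]
  refine Prod.ext ?_ (ContinuousLinearMap.ext fun w => ?_)
  -- The vector component is the naturality of the Lie bracket.
  · have : IsManifold I (minSmoothness ℝ 2) N := IsManifold.of_le minSmoothness_two_le_infty
    let V : E → E := fun y' => (pullbackSection Φ a y').1
    let W : E → E := fun y' => (pullbackSection Φ b y').1
    have e1 : (pullbackSection Φ (courantBracket a b) y).1 = VectorField.lieBracket ℝ V W y :=
      (VectorField.mpullback_mlieBracket (n := ∞) (ha.1.mdifferentiableAt (by simp))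
        (hb.1.mdifferentiableAt (by simp)) hΦ.contMDiffAt minSmoothness_two_le_infty).trans
          (congrFun (mlieBracket_eq_lieBracket _ _) y)
    rw [e1, VectorField.lieBracket, (h1 hda).fderiv, (h1 hdb).fderiv, flatBracket, jetBracket]
    simp [V, W]
  -- For the one-form, Cartan's formula leaves first derivatives of the pulled-back components. The
  -- product rule for the contractions cancels the antisymmetrizing terms of `dξ` and `dη`, and the
  -- half differential turns the rest into the two pairing terms of `jetBracket`.
  · have e1 : (pullbackSection Φ (courantBracket a b) y).2 w =
      (courantBracket a b (Φ y)).2 (mfderiv 𝓘(ℝ, E) I Φ y w) := rfl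
    have e2 : (courantBracket a b (Φ y)).2 (mfderiv 𝓘(ℝ, E) I Φ y w) =
      (interiorExtDeriv (fun z => (b z).2) (Φ y) (a (Φ y)).1 (mfderiv 𝓘(ℝ, E) I Φ y w)
        + differential (fun z => (b z).2 (a z).1) (Φ y) (mfderiv 𝓘(ℝ, E) I Φ y w))
      - (interiorExtDeriv (fun z => (a z).2) (Φ y) (b (Φ y)).1 (mfderiv 𝓘(ℝ, E) I Φ y w)
        + differential (fun z => (a z).2 (b z).1) (Φ y) (mfderiv 𝓘(ℝ, E) I Φ y w))
      + (1 / 2 : ℝ) * differential (fun z => (a z).2 (b z).1 - (b z).2 (a z).1) (Φ y)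
        (mfderiv 𝓘(ℝ, E) I Φ y w) := rfl
    have hab := hcd hda hdb w
    have hba := hcd hdb hda w
    have i1 := interiorExtDeriv_apply hΦ hb (pullbackSection Φ a y).1 w
    have i2 := interiorExtDeriv_apply hΦ ha (pullbackSection Φ b y).1 w
    rw [← hX] at i1 i2
    have d3 := differential_apply hΦ (f := fun z => (a z).2 (b z).1 - (b z).2 (a z).1) ((hc a b).sub (hc b a)) (hab.1.sub hba.1) w
    rw [fderiv_sub hab.1 hba.1, sub_apply, hab.2, hba.2] at d3
    have d1 := differential_apply hΦ (hc b a) hba.1 w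
    have d2 := differential_apply hΦ (hc a b) hab.1 w
    rw [hba.2] at d1
    rw [hab.2] at d2
    rw [e1, e2, i1, i2, d1, d2, d3, (h2 hda).fderiv, (h2 hdb).fderiv, flatBracket, jetBracket]
    simp [pairingCLM_apply, pairing]
    ring

end Naturality

/-! ### Eigenspaces under linear isomorphisms -/

section Pull
variable {A B : Type*} [AddCommGroup A] [Module ℝ A] [TopologicalSpace A]
  [AddCommGroup B] [Module ℝ B] [TopologicalSpace B]

theorem genMap_symm_inEigenspace_iff (e : A ≃L[ℝ] B) {J : GenSpace B →ₗ[ℝ] GenSpace B}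
    {T : GenSpace A →ₗ[ℝ] GenSpace A} (h : ∀ g, (genMap e).symm (J g) = T ((genMap e).symm g))
    (p p' : GenSpace B) : InEigenspace T ((genMap e).symm p) ((genMap e).symm p') ↔
      InEigenspace J p p' := by
  rw [InEigenspace, InEigenspace, ← h, ← h, ← map_neg, EmbeddingLike.apply_eq_iff_eq,
    EmbeddingLike.apply_eq_iff_eq]

end Pull

/-! ### Integrability and smoothness in local parametrizations -/

section Representation
variable {E : Type*} [NormedAddCommGroup E] [NormedSpace ℝ E] [CompleteSpace E]
  {H : Type*} [TopologicalSpace H] {I : ModelWithCorners ℝ E H}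
  {N : Type*} [TopologicalSpace N] [ChartedSpace H N]

/-- A local diffeomorphism carries neighbourhoods to neighbourhoods: continuity of its local inverse
transfers the property. -/
theorem eventually_nhds_of_comp {Φ : E → N} {y : E} (hΦ : IsLocalDiffeomorphAt 𝓘(ℝ, E) I ∞ Φ y)
    {p : N → Prop} (h : ∀ᶠ y' in 𝓝 y, p (Φ y')) : ∀ᶠ z in 𝓝 (Φ y), p z := by
  have h2 : hΦ.localInverse (Φ y) = y := hΦ.localInverse_left_inv hΦ.localInverse_mem_target
  have h3 : ∀ᶠ x in 𝓝 (hΦ.localInverse (Φ y)), p (Φ x) := by rw [h2]; exact h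
  filter_upwards [hΦ.localInverse_contMDiffAt.continuousAt.eventually h3,
    hΦ.localInverse_eventuallyEq_right] with z hz hz'
  have hz'' : Φ (hΦ.localInverse z) = z := hz'
  rwa [hz''] at hz

/-- Every section over `E` is locally the pullback of a section over `N`. -/
theorem exists_pullbackSection_eq {Φ : E → N} {y : E} (hΦ : IsLocalDiffeomorphAt 𝓘(ℝ, E) I ∞ Φ y)
    (f : E → GenSpace E) : ∃ a : GenSection I N, pullbackSection Φ a =ᶠ[𝓝 y] f := by
  let ψ : N → E := hΦ.localInverse
  -- Pull `f` back along the local inverse of `Φ`; the values far from `Φ y` are arbitrary.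
  refine ⟨fun z => pull (B := TangentSpace 𝓘(ℝ, E) (ψ z)) (mfderiv I 𝓘(ℝ, E) ψ z) (f (ψ z)), ?_⟩
  filter_upwards [eventually_isLocalDiffeomorphAt hΦ, hΦ.localInverse_eventuallyEq_left.eventuallyEq_nhds,
    hΦ.contMDiffAt.continuousAt.eventually
      (eventually_isLocalDiffeomorphAt hΦ.localInverse_isLocalDiffeomorphAt)] with y' h1 h2 h3
  have h4 : mfderiv 𝓘(ℝ, E) 𝓘(ℝ, E) (ψ ∘ Φ) y' = ContinuousLinearMap.id ℝ E := by
    rw [mfderiv_eq_fderiv, h2.fderiv_eq]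
    exact fderiv_id
  have h5 := pull_comp (h1.mfderivToContinuousLinearEquiv (by simp))
    (h3.mfderivToContinuousLinearEquiv (by simp)) (f (ψ (Φ y')))
  refine h5.symm.trans ?_
  have h6 : (h3.mfderivToContinuousLinearEquiv (by simp) :
      TangentSpace I (Φ y') →L[ℝ] TangentSpace 𝓘(ℝ, E) (ψ (Φ y'))).comp
      (h1.mfderivToContinuousLinearEquiv (by simp) : TangentSpace 𝓘(ℝ, E) y' →L[ℝ] TangentSpace I (Φ y'))
      = ContinuousLinearMap.id ℝ E := by
    rw [← h4, mfderiv_comp y' (h3.mdifferentiableAt (by simp)) (h1.mdifferentiableAt (by simp))]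
    rfl
  have h7 : ψ (Φ y') = y' := h2.eq_of_nhds
  have h8 : ∀ g : GenSpace E, pull (ContinuousLinearMap.id ℝ E) g = g := fun g => by
    rw [pull, ContinuousLinearMap.inverse_id]
    rfl
  have h9 : ∀ L : E →L[ℝ] E, L = ContinuousLinearMap.id ℝ E → pull L (f (ψ (Φ y'))) = f y' := by
    rintro L rfl
    rw [h8, h7]
  exact h9 _ h6

/-- In the local parametrization `Φ`, the field `J` of endomorphisms of `T_N ⊕ T_N^∨` is the field `T`
of endomorphisms of `E ⊕ E^∨`. -/
def Represents (Φ : E → N) (Ω : Set E)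
    (J : ∀ z : N, GenSpace (TangentSpace I z) →ₗ[ℝ] GenSpace (TangentSpace I z))
    (T : E → GenSpace E →ₗ[ℝ] GenSpace E) : Prop :=
  ∀ y ∈ Ω, ∀ g : GenSpace (TangentSpace I (Φ y)),
    pull (A := TangentSpace 𝓘(ℝ, E) y) (mfderiv 𝓘(ℝ, E) I Φ y) (J (Φ y) g) =
      T y (pull (A := TangentSpace 𝓘(ℝ, E) y) (mfderiv 𝓘(ℝ, E) I Φ y) g)

section Pointwise
variable {Φ : E → N} {Ω : Set E}
  {J : ∀ z : N, GenSpace (TangentSpace I z) →ₗ[ℝ] GenSpace (TangentSpace I z)}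
  {T : E → GenSpace E →ₗ[ℝ] GenSpace E}

theorem Represents.pullbackSection_apply (h : Represents Φ Ω J T) (a : GenSection I N) {y : E}
    (hy : y ∈ Ω) : pullbackSection Φ (fun z => J z (a z)) y = T y (pullbackSection Φ a y) :=
  h y hy _

theorem pull_mfderiv_eq {y : E} (hΦ : IsLocalDiffeomorphAt 𝓘(ℝ, E) I ∞ Φ y)
    (g : GenSpace (TangentSpace I (Φ y))) :
    pull (A := TangentSpace 𝓘(ℝ, E) y) (mfderiv 𝓘(ℝ, E) I Φ y) g =
      (genMap (hΦ.mfderivToContinuousLinearEquiv (by simp))).symm g :=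
  pull_coe (hΦ.mfderivToContinuousLinearEquiv (by simp)) g

theorem Represents.inEigenspace_iff (h : Represents Φ Ω J T) {y : E} (hy : y ∈ Ω)
    (hΦ : IsLocalDiffeomorphAt 𝓘(ℝ, E) I ∞ Φ y) (p p' : GenSpace (TangentSpace I (Φ y))) :
    InEigenspace (T y) (pull (A := TangentSpace 𝓘(ℝ, E) y) (mfderiv 𝓘(ℝ, E) I Φ y) p)
      (pull (A := TangentSpace 𝓘(ℝ, E) y) (mfderiv 𝓘(ℝ, E) I Φ y) p') ↔ InEigenspace (J (Φ y)) p p' := by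
  have h1 := h y hy
  simp only [pull_mfderiv_eq hΦ] at h1 ⊢
  exact genMap_symm_inEigenspace_iff _ h1 p p'

theorem pull_sub {y : E} (hΦ : IsLocalDiffeomorphAt 𝓘(ℝ, E) I ∞ Φ y)
    (p q : GenSpace (TangentSpace I (Φ y))) :
    pull (A := TangentSpace 𝓘(ℝ, E) y) (mfderiv 𝓘(ℝ, E) I Φ y) (p - q) =
      pull (A := TangentSpace 𝓘(ℝ, E) y) (mfderiv 𝓘(ℝ, E) I Φ y) p -
      pull (A := TangentSpace 𝓘(ℝ, E) y) (mfderiv 𝓘(ℝ, E) I Φ y) q := by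
  simp only [pull_mfderiv_eq hΦ, map_sub]

theorem pull_add {y : E} (hΦ : IsLocalDiffeomorphAt 𝓘(ℝ, E) I ∞ Φ y)
    (p q : GenSpace (TangentSpace I (Φ y))) :
    pull (A := TangentSpace 𝓘(ℝ, E) y) (mfderiv 𝓘(ℝ, E) I Φ y) (p + q) =
      pull (A := TangentSpace 𝓘(ℝ, E) y) (mfderiv 𝓘(ℝ, E) I Φ y) p +
      pull (A := TangentSpace 𝓘(ℝ, E) y) (mfderiv 𝓘(ℝ, E) I Φ y) q := by
  simp only [pull_mfderiv_eq hΦ, map_add]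

variable [I.Boundaryless] [IsManifold I ∞ N]

theorem Represents.isSmoothAt_apply (h : Represents Φ Ω J T) (hΩ : IsOpen Ω) (hT : FlatSmooth T Ω)
    {y : E} (hy : y ∈ Ω) (hΦ : ∀ y ∈ Ω, IsLocalDiffeomorphAt 𝓘(ℝ, E) I ∞ Φ y) {U : Set N}
    (hU : IsOpen U) (hyU : Φ y ∈ U) {a : GenSection I N} (ha : ∀ z ∈ U, IsSmoothAt a z) :
    IsSmoothAt (fun z => J z (a z)) (Φ y) := by
  have hc : ContinuousOn Φ Ω := fun y' hy' => (hΦ y' hy').contMDiffAt.continuousAt.continuousWithinAt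
  have ho : IsOpen (Ω ∩ Φ ⁻¹' U) := hc.isOpen_inter_preimage hΩ hU
  have h1 : ContDiffOn ℝ ∞ (pullbackSection Φ a) (Ω ∩ Φ ⁻¹' U) := fun y' hy' =>
    ((isSmoothAt_iff (hΦ y' hy'.1)).1 (ha _ hy'.2)).contDiffWithinAt
  have h2 := (hT _ inter_subset_left ho _ h1).contDiffAt (ho.mem_nhds ⟨hy, hyU⟩)
  rw [isSmoothAt_iff (hΦ y hy)]
  refine h2.congr_of_eventuallyEq ?_
  filter_upwards [hΩ.mem_nhds hy] with y' hy'
  exact h.pullbackSection_apply a hy'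

end Pointwise

section Structure
variable [I.Boundaryless] [IsManifold I ∞ N] {J : GenAlmostComplexStructure I N} {Φ : E → N} {Ω : Set E}
  {T : E → GenSpace E →ₗ[ℝ] GenSpace E}

theorem exists_isSmoothOn_pullbackSection_eq (hΦ : ∀ y ∈ Ω, IsLocalDiffeomorphAt 𝓘(ℝ, E) I ∞ Φ y)
    {U : Set E} (hU : U ⊆ Ω) (hUo : IsOpen U) {f : E → GenSpace E} (hf : ContDiffOn ℝ ∞ f U) {y : E}
    (hy : y ∈ U) : ∃ a : GenSection I N, pullbackSection Φ a =ᶠ[𝓝 y] f ∧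
      ∀ᶠ z in 𝓝 (Φ y), IsSmoothAt a z := by
  obtain ⟨a, ha⟩ := exists_pullbackSection_eq (hΦ y (hU hy)) f
  refine ⟨a, ha, eventually_nhds_of_comp (hΦ y (hU hy)) ?_⟩
  filter_upwards [ha.eventuallyEq_nhds, hUo.mem_nhds hy] with y' h1 h2
  rw [isSmoothAt_iff (hΦ y' (hU h2))]
  exact (hf.contDiffAt (hUo.mem_nhds h2)).congr_of_eventuallyEq h1

/-- Test sections on `E` are germs of pullbacks of smooth local sections on `N`, to which smoothness
of `J` applies. -/
theorem Represents.flatSmooth (h : Represents Φ Ω J.toFun T) (hΩ : IsOpen Ω)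
    (hΦ : ∀ y ∈ Ω, IsLocalDiffeomorphAt 𝓘(ℝ, E) I ∞ Φ y) : FlatSmooth T Ω := by
  intro U hU hUo f hf y hy
  obtain ⟨a, ha, has⟩ := exists_isSmoothOn_pullbackSection_eq hΦ hU hUo hf hy
  obtain ⟨V, hV, hVo, hyV⟩ := eventually_nhds_iff.1 has
  have h1 := (isSmoothOn_iff hVo).1 (J.smooth V hVo a ((isSmoothOn_iff hVo).2 hV)) _ hyV
  rw [isSmoothAt_iff (hΦ y (hU hy))] at h1
  refine (h1.congr_of_eventuallyEq ?_).contDiffWithinAt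
  filter_upwards [ha, hΩ.mem_nhds (hU hy)] with y' h2 h3
  rw [h.pullbackSection_apply a h3, h2]

/-- Only germs matter: near `Φ y` the test sections come from smooth eigensections on `N`, and the
bracket commutes with the pullback. -/
theorem Represents.flatIntegrable (h : Represents Φ Ω J.toFun T)
    (hΦ : ∀ y ∈ Ω, IsLocalDiffeomorphAt 𝓘(ℝ, E) I ∞ Φ y) (hJ : J.Integrable) :
    FlatIntegrable T Ω := by
  intro U hU hUo f f' g g' hf hf' hg hg' hfe hge y hy
  have hy' := hΦ y (hU hy)
  obtain ⟨a, ha, has⟩ := exists_isSmoothOn_pullbackSection_eq hΦ hU hUo hf hy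
  obtain ⟨a', ha', has'⟩ := exists_isSmoothOn_pullbackSection_eq hΦ hU hUo hf' hy
  obtain ⟨b, hb, hbs⟩ := exists_isSmoothOn_pullbackSection_eq hΦ hU hUo hg hy
  obtain ⟨b', hb', hbs'⟩ := exists_isSmoothOn_pullbackSection_eq hΦ hU hUo hg' hy
  have he : ∀ {s s' : GenSection I N} {k k' : E → GenSpace E}, pullbackSection Φ s =ᶠ[𝓝 y] k →
      pullbackSection Φ s' =ᶠ[𝓝 y] k' → (∀ y ∈ U, InEigenspace (T y) (k y) (k' y)) →
      ∀ᶠ z in 𝓝 (Φ y), InEigenspace (J.toFun z) (s z) (s' z) := by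
    intro s s' k k' hs hs' hk
    refine eventually_nhds_of_comp hy' ?_
    filter_upwards [hs, hs', hUo.mem_nhds hy] with y' h1 h2 h3
    rw [← h.inEigenspace_iff (hU h3) (hΦ y' (hU h3))]
    have := hk y' h3
    rwa [← h1, ← h2] at this
  obtain ⟨V, hV, hVo, hyV⟩ := eventually_nhds_iff.1 ((has.and has').and ((hbs.and hbs').and
    ((he ha ha' hfe).and (he hb hb' hge))))
  have key := hJ V hVo a a' b b' ((isSmoothOn_iff hVo).2 fun z hz => (hV z hz).1.1)
    ((isSmoothOn_iff hVo).2 fun z hz => (hV z hz).1.2)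
    ((isSmoothOn_iff hVo).2 fun z hz => (hV z hz).2.1.1)
    ((isSmoothOn_iff hVo).2 fun z hz => (hV z hz).2.1.2)
    (fun z hz => (hV z hz).2.2.1) (fun z hz => (hV z hz).2.2.2) _ hyV
  rw [← h.inEigenspace_iff (hU hy) hy', pull_sub hy', pull_add hy'] at key
  have hbr : ∀ {s t : GenSection I N} {k l : E → GenSpace E}, pullbackSection Φ s =ᶠ[𝓝 y] k →
      pullbackSection Φ t =ᶠ[𝓝 y] l → IsSmoothAt s (Φ y) → IsSmoothAt t (Φ y) →
      pull (A := TangentSpace 𝓘(ℝ, E) y) (mfderiv 𝓘(ℝ, E) I Φ y) (courantBracket s t (Φ y)) =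
        flatBracket k l y := fun hs ht hss hts =>
    (pull_courantBracket hy' hss hts).trans (flatBracket_congr hs ht)
  have hz := hV _ hyV
  rwa [hbr ha hb hz.1.1 hz.2.1.1, hbr ha' hb' hz.1.2 hz.2.1.2, hbr ha hb' hz.1.1 hz.2.1.2,
    hbr ha' hb hz.1.2 hz.2.1.1] at key

theorem Represents.inEigenspace_courantBracket (h : Represents Φ Ω J.toFun T) (hΩ : IsOpen Ω)
    (hΦ : ∀ y ∈ Ω, IsLocalDiffeomorphAt 𝓘(ℝ, E) I ∞ Φ y) (hT : FlatIntegrable T Ω) {U : Set N}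
    (hU : IsOpen U) {a a' b b' : GenSection I N} (ha : IsSmoothOn a U) (ha' : IsSmoothOn a' U)
    (hb : IsSmoothOn b U) (hb' : IsSmoothOn b' U)
    (hae : ∀ z ∈ U, InEigenspace (J.toFun z) (a z) (a' z))
    (hbe : ∀ z ∈ U, InEigenspace (J.toFun z) (b z) (b' z)) {y : E} (hy : y ∈ Ω) (hyU : Φ y ∈ U) :
    InEigenspace (J.toFun (Φ y)) (courantBracket a b (Φ y) - courantBracket a' b' (Φ y))
      (courantBracket a b' (Φ y) + courantBracket a' b (Φ y)) := by
  rw [isSmoothOn_iff hU] at ha ha' hb hb'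
  have hc : ContinuousOn Φ Ω := fun y' hy' => (hΦ y' hy').contMDiffAt.continuousAt.continuousWithinAt
  have ho : IsOpen (Ω ∩ Φ ⁻¹' U) := hc.isOpen_inter_preimage hΩ hU
  have h1 : ∀ {s : GenSection I N}, (∀ z ∈ U, IsSmoothAt s z) →
      ContDiffOn ℝ ∞ (pullbackSection Φ s) (Ω ∩ Φ ⁻¹' U) := fun hs y' hy' =>
    ((isSmoothAt_iff (hΦ y' hy'.1)).1 (hs _ hy'.2)).contDiffWithinAt
  have key := hT _ inter_subset_left ho _ _ _ _ (h1 ha) (h1 ha') (h1 hb) (h1 hb')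
    (fun y' hy' => (h.inEigenspace_iff hy'.1 (hΦ y' hy'.1) _ _).2 (hae _ hy'.2))
    (fun y' hy' => (h.inEigenspace_iff hy'.1 (hΦ y' hy'.1) _ _).2 (hbe _ hy'.2)) y ⟨hy, hyU⟩
  have hy' := hΦ y hy
  rw [← h.inEigenspace_iff hy hy', pull_sub hy', pull_add hy']
  rwa [← pull_courantBracket hy' (ha _ hyU) (hb _ hyU), ← pull_courantBracket hy' (ha' _ hyU) (hb' _ hyU),
    ← pull_courantBracket hy' (ha _ hyU) (hb' _ hyU),
    ← pull_courantBracket hy' (ha' _ hyU) (hb _ hyU)] at key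

end Structure

end Representation

/-! ### The duality exchanging `ℝⁿ` and its dual -/

section Shuffle
variable {n : ℕ} {T T₂ : Type*} [AddCommGroup T] [Module ℝ T] [TopologicalSpace T]
  [AddCommGroup T₂] [Module ℝ T₂] [TopologicalSpace T₂]

theorem apply_prod_eq_sum (f : (Fin n → ℝ) × T →L[ℝ] ℝ) (v : Fin n → ℝ) (t : T) :
    f (v, t) = v ⬝ᵥ (fun k => f (Pi.single k 1, 0)) + f (0, t) := by
  have h1 : f (v, t) = f (v, 0) + f (0, t) := by rw [← map_add]; simp
  have h2 : (v, (0 : T)) = ∑ k, v k • (Pi.single k 1, 0) := by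
    refine Prod.ext ?_ ?_
    · rw [Prod.fst_sum]
      funext j
      simp [Finset.sum_apply, Pi.single_apply]
    · rw [Prod.snd_sum]
      simp
  rw [h1, h2, map_sum]
  simp only [dotProduct, map_smul, smul_eq_mul]

theorem shuffle_fst (a : GenSpace ((Fin n → ℝ) × T)) :
    (shuffle n T a).1 = (fun k => a.2 (Pi.single k 1, 0), a.1.2) := rfl

theorem shuffle_snd_apply (a : GenSpace ((Fin n → ℝ) × T)) (v : Fin n → ℝ) (t : T) :
    (shuffle n T a).2 (v, t) = a.1.1 ⬝ᵥ v + a.2 (0, t) := by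
  simp [shuffle, dotProduct]

/-- Splitting each functional into its `ℝⁿ` and `T` parts, the shuffle merely interchanges the two
`ℝⁿ` terms of the pairing. -/
theorem pairing_shuffle (a b : GenSpace ((Fin n → ℝ) × T)) :
    pairing (shuffle n T a) (shuffle n T b) = pairing a b := by
  obtain ⟨⟨v, t⟩, f⟩ := a
  obtain ⟨⟨w, u⟩, g⟩ := b
  simp only [pairing, shuffle_fst, shuffle_snd_apply]
  rw [apply_prod_eq_sum f w u, apply_prod_eq_sum g v t]
  ring

theorem shuffle_mem_leftPart {a : GenSpace ((Fin n → ℝ) × T)} (ha : a ∈ leftPart (Fin n → ℝ) T) :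
    shuffle n T a ∈ leftPart (Fin n → ℝ) T :=
  ⟨ha.1, fun y => by rw [shuffle_snd_apply, dotProduct_zero, zero_add, ha.2]⟩

theorem shuffle_mem_rightPart {a : GenSpace ((Fin n → ℝ) × T)} (ha : a ∈ rightPart (Fin n → ℝ) T) :
    shuffle n T a ∈ rightPart (Fin n → ℝ) T := by
  refine ⟨funext fun k => ha.2 _, fun x => ?_⟩
  have h : a.2 ((0 : Fin n → ℝ), (0 : T)) = 0 := map_zero a.2
  rw [shuffle_snd_apply, ha.1, zero_dotProduct, h, add_zero]

/-- Conjugation by the duality that exchanges `ℝⁿ` and its dual. -/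
def shuffleConj (K : GenSpace ((Fin n → ℝ) × T) →ₗ[ℝ] GenSpace ((Fin n → ℝ) × T)) :
    GenSpace ((Fin n → ℝ) × T) →ₗ[ℝ] GenSpace ((Fin n → ℝ) × T) :=
  shuffle n T ∘ₗ K ∘ₗ shuffle n T

theorem shuffleConj_apply (K : GenSpace ((Fin n → ℝ) × T) →ₗ[ℝ] GenSpace ((Fin n → ℝ) × T))
    (a : GenSpace ((Fin n → ℝ) × T)) : shuffleConj K a = shuffle n T (K (shuffle n T a)) := rfl

theorem shuffleConj_shuffleConj (K : GenSpace ((Fin n → ℝ) × T) →ₗ[ℝ] GenSpace ((Fin n → ℝ) × T)) :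
    shuffleConj (shuffleConj K) = K :=
  LinearMap.ext fun a => by simp only [shuffleConj_apply, shuffle_shuffle]

theorem isGenComplex_shuffleConj {K : GenSpace ((Fin n → ℝ) × T) →ₗ[ℝ] GenSpace ((Fin n → ℝ) × T)}
    (hK : IsGenComplex K) : IsGenComplex (shuffleConj K) :=
  ⟨fun a => by simp only [shuffleConj_apply, shuffle_shuffle, hK.sq, map_neg],
    fun a b => by simp only [shuffleConj_apply, pairing_shuffle, hK.orthogonal]⟩

/-- The shuffle is an involution that maps each of the two parts into itself. -/
theorem shuffleConj_image_leftPart {K : GenSpace ((Fin n → ℝ) × T) →ₗ[ℝ] GenSpace ((Fin n → ℝ) × T)}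
    (hK : K '' leftPart (Fin n → ℝ) T = rightPart (Fin n → ℝ) T) :
    shuffleConj K '' leftPart (Fin n → ℝ) T = rightPart (Fin n → ℝ) T := by
  refine Subset.antisymm ?_ fun b hb => ?_
  · rintro _ ⟨a, ha, rfl⟩
    exact shuffle_mem_rightPart (hK ▸ mem_image_of_mem K (shuffle_mem_leftPart ha))
  · have := shuffle_mem_rightPart hb
    rw [← hK] at this
    obtain ⟨a, ha, hab⟩ := this
    exact ⟨shuffle n T a, shuffle_mem_leftPart ha, by
      rw [shuffleConj_apply, shuffle_shuffle, hab, shuffle_shuffle]⟩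

/-- The action of `GL(n, ℤ)` on `ℝⁿ` by linear isomorphisms. -/
def realActionEquiv (g : GL (Fin n) ℤ) : (Fin n → ℝ) ≃L[ℝ] (Fin n → ℝ) :=
  ContinuousLinearEquiv.equivOfInverse (realAction g) (realAction g⁻¹)
    (fun v => by rw [← realAction_mul, inv_mul_cancel, realAction_one])
    (fun v => by rw [← realAction_mul, mul_inv_cancel, realAction_one])

theorem realAction_contragredient_dotProduct (g : GL (Fin n) ℤ) (v w : Fin n → ℝ) :
    realAction (contragredient g) v ⬝ᵥ w = v ⬝ᵥ realAction g⁻¹ w := by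
  rw [realAction_apply, realAction_apply, contragredient, Matrix.transpose_map,
    Matrix.mulVec_transpose, Matrix.dotProduct_mulVec]

theorem realAction_contragredient_inv_dotProduct (g : GL (Fin n) ℤ) (v w : Fin n → ℝ) :
    realAction (contragredient g)⁻¹ v ⬝ᵥ w = v ⬝ᵥ realAction g w := by
  have h : ((contragredient g)⁻¹ : GL (Fin n) ℤ).1 = (g : Matrix (Fin n) (Fin n) ℤ).transpose := rfl
  rw [realAction_apply, realAction_apply, h, Matrix.transpose_map, Matrix.mulVec_transpose,
    Matrix.dotProduct_mulVec]

/-- Dual frames change by the transposed inverse matrix, so the exchange is independent of the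
frame; this makes the mirror field compatible with the transition functions. -/
theorem shuffle_genMap (g : GL (Fin n) ℤ) (D : T ≃L[ℝ] T₂) (a : GenSpace ((Fin n → ℝ) × T)) :
    shuffle n T₂ (genMap ((realActionEquiv (contragredient g)).prodCongr D) a) =
      genMap ((realActionEquiv g).prodCongr D) (shuffle n T a) := by
  obtain ⟨⟨v, t⟩, f⟩ := a
  have h0 : f (0, 0) = 0 := map_zero f
  refine Prod.ext (Prod.ext (funext fun k => ?_) rfl) (ContinuousLinearMap.ext ?_)
  · change f (realAction (contragredient g)⁻¹ (Pi.single k 1), D.symm 0) =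
      realAction g (fun k => f (Pi.single k 1, 0)) k
    rw [map_zero, apply_prod_eq_sum, h0, add_zero, realAction_contragredient_inv_dotProduct,
      single_one_dotProduct]
  · rintro ⟨w, u⟩
    rw [shuffle_snd_apply]
    change realAction (contragredient g) v ⬝ᵥ w +
      f (realAction (contragredient g)⁻¹ 0, D.symm u) =
      (shuffle n T ((v, t), f)).2 (realAction g⁻¹ w, D.symm u)
    rw [shuffle_snd_apply, realAction_contragredient_dotProduct, map_zero]

end Shuffle

/-! ### The duality as a horizontal isometry -/

section SwappedShuffle
variable (n : ℕ) (A : Type*) [NormedAddCommGroup A] [NormedSpace ℝ A] [FiniteDimensional ℝ A]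

/-- The duality that exchanges `ℝⁿ` and its dual, on `(A × ℝⁿ) ⊕ (A × ℝⁿ)^∨`. -/
def swappedShuffle : GenSpace (A × (Fin n → ℝ)) →L[ℝ] GenSpace (A × (Fin n → ℝ)) :=
  ((genMap (ContinuousLinearEquiv.prodComm ℝ A (Fin n → ℝ))).symm.toLinearMap ∘ₗ shuffle n A ∘ₗ
    (genMap (ContinuousLinearEquiv.prodComm ℝ A (Fin n → ℝ))).toLinearMap).toContinuousLinearMap

variable {n A}

theorem swappedShuffle_apply (a : GenSpace (A × (Fin n → ℝ))) : swappedShuffle n A a =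
    (genMap (ContinuousLinearEquiv.prodComm ℝ A (Fin n → ℝ))).symm
      (shuffle n A (genMap (ContinuousLinearEquiv.prodComm ℝ A (Fin n → ℝ)) a)) := rfl

/-- Conjugating by a frame of the dual bundle the endomorphism dual to `K`. -/
theorem genMap_symm_shuffleConj (g : GL (Fin n) ℤ) {T : Type*} [AddCommGroup T] [Module ℝ T]
    [TopologicalSpace T] (D : A ≃L[ℝ] T)
    (K : GenSpace ((Fin n → ℝ) × T) →ₗ[ℝ] GenSpace ((Fin n → ℝ) × T))
    (a : GenSpace (A × (Fin n → ℝ))) :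
    (genMap ((ContinuousLinearEquiv.prodComm ℝ A (Fin n → ℝ)).trans
      ((realActionEquiv (contragredient g)).prodCongr D))).symm
      (shuffleConj K (genMap ((ContinuousLinearEquiv.prodComm ℝ A (Fin n → ℝ)).trans
        ((realActionEquiv (contragredient g)).prodCongr D)) a)) =
    swappedShuffle n A ((genMap ((ContinuousLinearEquiv.prodComm ℝ A (Fin n → ℝ)).trans
      ((realActionEquiv g).prodCongr D))).symm
      (K (genMap ((ContinuousLinearEquiv.prodComm ℝ A (Fin n → ℝ)).trans
        ((realActionEquiv g).prodCongr D)) (swappedShuffle n A a)))) := by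
  let e := ContinuousLinearEquiv.prodComm ℝ A (Fin n → ℝ)
  let G := genMap ((realActionEquiv g).prodCongr D)
  let G' := genMap ((realActionEquiv (contragredient g)).prodCongr D)
  have h1 : ∀ b, shuffle n T (G' b) = G (shuffle n A b) := fun b => shuffle_genMap g D b
  have h2 : ∀ b, G'.symm (shuffle n T b) = shuffle n A (G.symm b) := by
    intro b
    rw [LinearEquiv.symm_apply_eq, ← shuffle_shuffle n T (G' _), h1, shuffle_shuffle,
      LinearEquiv.apply_symm_apply]
  have h3 : ∀ b, genMap (e.trans ((realActionEquiv g).prodCongr D)) b = G (genMap e b) := fun b => rfl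
  have h4 : ∀ b, genMap (e.trans ((realActionEquiv (contragredient g)).prodCongr D)) b =
      G' (genMap e b) := fun b => rfl
  have h5 : ∀ b, (genMap (e.trans ((realActionEquiv g).prodCongr D))).symm b =
      (genMap e).symm (G.symm b) := fun b => rfl
  have h6 : ∀ b, (genMap (e.trans ((realActionEquiv (contragredient g)).prodCongr D))).symm b =
      (genMap e).symm (G'.symm b) := fun b => rfl
  rw [h3, h4, h5, h6, shuffleConj_apply, h1, h2, swappedShuffle_apply, swappedShuffle_apply,
    LinearEquiv.apply_symm_apply, LinearEquiv.apply_symm_apply]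

theorem pairing_genMap {W W₂ : Type*} [AddCommGroup W] [Module ℝ W] [TopologicalSpace W]
    [AddCommGroup W₂] [Module ℝ W₂] [TopologicalSpace W₂] (e : W ≃L[ℝ] W₂) (a b : GenSpace W) :
    pairing (genMap e a) (genMap e b) = pairing a b := by
  simp [pairing, genMap]

theorem pairing_genMap_symm {W W₂ : Type*} [AddCommGroup W] [Module ℝ W] [TopologicalSpace W]
    [AddCommGroup W₂] [Module ℝ W₂] [TopologicalSpace W₂] (e : W ≃L[ℝ] W₂) (a b : GenSpace W₂) :
    pairing ((genMap e).symm a) ((genMap e).symm b) = pairing a b := by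
  rw [← pairing_genMap e, LinearEquiv.apply_symm_apply, LinearEquiv.apply_symm_apply]

/-- The exchange moves only the fibre vectors and the fibre covectors; base vectors and forms pulled
back from the base stay in place. -/
theorem isHorizontalIsometry_swappedShuffle : IsHorizontalIsometry (swappedShuffle n A) where
  involutive a := by
    rw [swappedShuffle_apply, swappedShuffle_apply, LinearEquiv.apply_symm_apply, shuffle_shuffle,
      LinearEquiv.symm_apply_apply]
  orthogonal a b := by
    rw [swappedShuffle_apply, swappedShuffle_apply, pairing_genMap_symm, pairing_shuffle, pairing_genMap]
  fst a := rfl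
  form θ hθ := by
    refine Prod.ext (Prod.ext rfl (funext fun k => hθ _)) (ContinuousLinearMap.ext ?_)
    rintro ⟨t, v⟩
    have h1 : (swappedShuffle n A (0, θ)).2 (t, v) = (0 : Fin n → ℝ) ⬝ᵥ v + θ (t, 0) :=
      shuffle_snd_apply _ v t
    have h2 : θ (t, v) = θ (t, 0) + θ (0, v) := by rw [← map_add]; simp
    rw [h1, h2, hθ, zero_dotProduct, zero_add, add_zero]

theorem isGenComplex_conj {W W₂ : Type*} [AddCommGroup W] [Module ℝ W] [TopologicalSpace W]
    [AddCommGroup W₂] [Module ℝ W₂] [TopologicalSpace W₂] (e : W ≃L[ℝ] W₂)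
    {K : GenSpace W →ₗ[ℝ] GenSpace W} (hK : IsGenComplex K) :
    IsGenComplex ((genMap e).toLinearMap ∘ₗ K ∘ₗ (genMap e).symm.toLinearMap) :=
  ⟨fun a => by simp [hK.sq], fun a b => by simp [pairing_genMap, pairing_genMap_symm, hK.orthogonal]⟩

theorem isGenComplex_conj_symm {W W₂ : Type*} [AddCommGroup W] [Module ℝ W] [TopologicalSpace W]
    [AddCommGroup W₂] [Module ℝ W₂] [TopologicalSpace W₂] (e : W ≃L[ℝ] W₂)
    {K : GenSpace W₂ →ₗ[ℝ] GenSpace W₂} (hK : IsGenComplex K) :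
    IsGenComplex ((genMap e).symm.toLinearMap ∘ₗ K ∘ₗ (genMap e).toLinearMap) :=
  ⟨fun a => by simp [hK.sq], fun a b => by simp [pairing_genMap, pairing_genMap_symm, hK.orthogonal]⟩

end SwappedShuffle

open LatticeCocycle

/-! ### Flat coordinates on the torus bundle -/

section Geometry
variable {ι M : Type*} {n : ℕ} [TopologicalSpace M] [ChartedSpace (EuclideanSpace ℝ (Fin n)) M]
  [IsManifold (𝓡 n) ∞ M] {c : LatticeCocycle ι M n}
  {Z : Type*} [TopologicalSpace Z]
  [ChartedSpace (ModelProd (EuclideanSpace ℝ (Fin n)) (Fin n → ℝ)) Z]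
  [IsManifold (totalModel n) ∞ Z]

/-- The differential of the inverse of the preferred chart at `x₀`. -/
def chartFrame (x₀ : M) (u : EuclideanSpace ℝ (Fin n)) :
    EuclideanSpace ℝ (Fin n) ≃L[ℝ] TangentSpace (𝓡 n) ((chartAt (EuclideanSpace ℝ (Fin n)) x₀).symm u) :=
  open scoped Classical in
  -- Off the target of the chart the derivative need not be invertible, and the identity serves as a
  -- default value.
  if h : ∃ e : EuclideanSpace ℝ (Fin n) ≃L[ℝ]
      TangentSpace (𝓡 n) ((chartAt (EuclideanSpace ℝ (Fin n)) x₀).symm u),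
      ∀ v, e v = mfderiv (𝓡 n) (𝓡 n) (chartAt (EuclideanSpace ℝ (Fin n)) x₀).symm u v
  then h.choose else ContinuousLinearEquiv.refl ℝ (EuclideanSpace ℝ (Fin n))

theorem isLocalDiffeomorphAt_chartAt_symm {x₀ : M} {u : EuclideanSpace ℝ (Fin n)}
    (hu : u ∈ (chartAt (EuclideanSpace ℝ (Fin n)) x₀).target) :
    IsLocalDiffeomorphAt (𝓡 n) (𝓡 n) ∞ (chartAt (EuclideanSpace ℝ (Fin n)) x₀).symm u := by
  have := isLocalDiffeomorphAt_extChartAt_symm (I := 𝓡 n) x₀ (w := u) (by simpa using hu)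
  simpa using! this

theorem chartFrame_apply {x₀ : M} {u : EuclideanSpace ℝ (Fin n)}
    (hu : u ∈ (chartAt (EuclideanSpace ℝ (Fin n)) x₀).target) (v : EuclideanSpace ℝ (Fin n)) :
    chartFrame x₀ u v = mfderiv (𝓡 n) (𝓡 n) (chartAt (EuclideanSpace ℝ (Fin n)) x₀).symm u v := by
  have h : ∃ e : EuclideanSpace ℝ (Fin n) ≃L[ℝ]
      TangentSpace (𝓡 n) ((chartAt (EuclideanSpace ℝ (Fin n)) x₀).symm u),
      ∀ v, e v = mfderiv (𝓡 n) (𝓡 n) (chartAt (EuclideanSpace ℝ (Fin n)) x₀).symm u v :=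
    ⟨(isLocalDiffeomorphAt_chartAt_symm hu).mfderivToContinuousLinearEquiv (by simp), fun v => rfl⟩
  have h1 : chartFrame x₀ u = h.choose := dif_pos h
  rw [h1]
  exact h.choose_spec v

/-- The matrix relating the frame of `V` of index `c.indexAt x₀` to the frame in which the fibre over the
point with coordinates `u` is read. -/
def frameMatrix (c : LatticeCocycle ι M n) (x₀ : M) (u : EuclideanSpace ℝ (Fin n)) : GL (Fin n) ℤ :=
  c.transition (c.indexAt x₀) (c.indexAt ((chartAt (EuclideanSpace ℝ (Fin n)) x₀).symm u))
    ((chartAt (EuclideanSpace ℝ (Fin n)) x₀).symm u)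

/-- The local frame of `V ⊕ T_M` given by the trivialization of index `c.indexAt x₀` and the preferred
chart at `x₀`. -/
def localFrame (c : LatticeCocycle ι M n) (x₀ : M) (u : EuclideanSpace ℝ (Fin n)) :
    (EuclideanSpace ℝ (Fin n) × (Fin n → ℝ)) ≃L[ℝ]
      (c.V ((chartAt (EuclideanSpace ℝ (Fin n)) x₀).symm u) ×
        TangentSpace (𝓡 n) ((chartAt (EuclideanSpace ℝ (Fin n)) x₀).symm u)) :=
  (ContinuousLinearEquiv.prodComm ℝ (EuclideanSpace ℝ (Fin n)) (Fin n → ℝ)).trans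
    ((realActionEquiv (frameMatrix c x₀ u)).prodCongr (chartFrame x₀ u))

/-- The expression in the local frame around `x₀` of a field of endomorphisms of
`(V ⊕ T_M) ⊕ (V ⊕ T_M)^∨`. -/
def localField (c : LatticeCocycle ι M n) (K : BaseField c) (x₀ : M) (u : EuclideanSpace ℝ (Fin n)) :
    GenSpace (EuclideanSpace ℝ (Fin n) × (Fin n → ℝ)) →ₗ[ℝ]
      GenSpace (EuclideanSpace ℝ (Fin n) × (Fin n → ℝ)) :=
  (genMap (localFrame c x₀ u)).symm.toLinearMap ∘ₗ K _ ∘ₗ (genMap (localFrame c x₀ u)).toLinearMap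

/-- In the frame of fixed index and its dual, passing to the mirror is conjugation by an isometry
that does not depend on `u`. -/
theorem localField_mirror (K : BaseField c) (x₀ : M) (u : EuclideanSpace ℝ (Fin n))
    (a : GenSpace (EuclideanSpace ℝ (Fin n) × (Fin n → ℝ))) :
    localField c.dual K.mirror x₀ u a =
      swappedShuffle n _ (localField c K x₀ u (swappedShuffle n _ a)) := by
  exact genMap_symm_shuffleConj (frameMatrix c x₀ u) (chartFrame x₀ u) (K _) a

theorem isGenComplex_localField {K : BaseField c} (hK : ∀ x, IsGenComplex (K x)) (x₀ : M)
    (u : EuclideanSpace ℝ (Fin n)) : IsGenComplex (localField c K x₀ u) :=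
  isGenComplex_conj_symm _ (hK _)

/-- The part of the preferred chart at `x₀` over which the trivialization of index `c.indexAt x₀` is
defined. -/
def chartDomain (c : LatticeCocycle ι M n) (x₀ : M) : Set (EuclideanSpace ℝ (Fin n)) :=
  (chartAt (EuclideanSpace ℝ (Fin n)) x₀).target ∩
    (chartAt (EuclideanSpace ℝ (Fin n)) x₀).symm ⁻¹' c.baseSet (c.indexAt x₀)

theorem isOpen_chartDomain (x₀ : M) : IsOpen (chartDomain c x₀) :=
  (chartAt (EuclideanSpace ℝ (Fin n)) x₀).isOpen_inter_preimage_symm (c.isOpen_baseSet _)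

namespace TorusBundle
variable (P : TorusBundle c Z)

/-- The local parametrization of `Z` over the preferred chart at `x₀`. -/
def localParam (x₀ : M) (y : EuclideanSpace ℝ (Fin n) × (Fin n → ℝ)) : Z :=
  P.param (c.indexAt x₀) ((chartAt (EuclideanSpace ℝ (Fin n)) x₀).symm y.1, y.2)

theorem exists_localParam_eq (z : Z) : ∃ x₀, ∃ y ∈ chartDomain c x₀ ×ˢ univ, P.localParam x₀ y = z := by
  obtain ⟨v, hv⟩ := P.param_surjective _ z (c.mem_baseSet_at (P.proj z))
  have h := (chartAt (EuclideanSpace ℝ (Fin n)) (P.proj z)).left_inv (mem_chart_source _ (P.proj z))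
  refine ⟨P.proj z, (chartAt (EuclideanSpace ℝ (Fin n)) (P.proj z) (P.proj z), v),
    ⟨⟨mem_chart_target _ _, ?_⟩, mem_univ _⟩, ?_⟩
  · rw [mem_preimage, h]; exact c.mem_baseSet_at _
  · rw [localParam, h]; exact hv

theorem exists_pointAt_eq (z : Z) : ∃ p : M × (Fin n → ℝ), P.pointAt p.1 p.2 = z := by
  obtain ⟨v, hv⟩ := P.param_surjective _ z (c.mem_baseSet_at (P.proj z))
  exact ⟨(P.proj z, v), hv⟩

theorem isLocalDiffeomorphAt_localParam (x₀ : M) {y : EuclideanSpace ℝ (Fin n) × (Fin n → ℝ)}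
    (hy : y ∈ chartDomain c x₀ ×ˢ univ) :
    IsLocalDiffeomorphAt 𝓘(ℝ, EuclideanSpace ℝ (Fin n) × (Fin n → ℝ)) (totalModel n) ∞
      (P.localParam x₀) y := by
  have h1 := isLocalDiffeomorphAt_extChartAt_symm (I := totalModel n) (x₀, (0 : Fin n → ℝ)) (w := y)
    (by
      rw [extChartAt_prod, PartialEquiv.prod_target]
      exact ⟨by simpa using hy.1.1, by rw [extChartAt_model_space_eq_id]; exact mem_univ _⟩)
  have h2 := P.isLocalDiffeomorphOn_param (c.indexAt x₀)
    ⟨((chartAt (EuclideanSpace ℝ (Fin n)) x₀).symm y.1, y.2), hy.1.2, mem_univ _⟩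
  have h3 : ∀ y : EuclideanSpace ℝ (Fin n) × (Fin n → ℝ),
      (extChartAt (totalModel n) (x₀, (0 : Fin n → ℝ))).symm y =
      ((chartAt (EuclideanSpace ℝ (Fin n)) x₀).symm y.1, y.2) := fun y => rfl
  exact h1.comp (hg := h2)

/-- The change of coordinates from the local parametrization around `x₀` to the trivialization at a point. -/
theorem localParam_eq_pointAt (x₀ : M) {u : EuclideanSpace ℝ (Fin n)} (hu : u ∈ chartDomain c x₀)
    (w : Fin n → ℝ) : P.localParam x₀ (u, w) =
      P.pointAt ((chartAt (EuclideanSpace ℝ (Fin n)) x₀).symm u) (realAction (frameMatrix c x₀ u) w) :=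
  (P.param_transition _ _ _ ⟨hu.2, c.mem_baseSet_at _⟩ w).symm

/-- Passing to the trivialization used at `x` is a linear map of the fibre that is constant near
`x`; no derivative of it appears, and the differential is the local frame followed by the flat
splitting. The equality is stated in the model space, since the base points of the two sides are
written differently. -/
theorem mfderiv_localParam (x₀ : M) {u : EuclideanSpace ℝ (Fin n)} (hu : u ∈ chartDomain c x₀)
    (w : Fin n → ℝ) :
    @Eq (EuclideanSpace ℝ (Fin n) × (Fin n → ℝ) →L[ℝ] EuclideanSpace ℝ (Fin n) × (Fin n → ℝ))
      (mfderiv 𝓘(ℝ, EuclideanSpace ℝ (Fin n) × (Fin n → ℝ)) (totalModel n) (P.localParam x₀) (u, w))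
      ((localFrame c x₀ u).trans (P.splitting ((chartAt (EuclideanSpace ℝ (Fin n)) x₀).symm u)
        (realAction (frameMatrix c x₀ u) w))).toContinuousLinearMap := by
  set ψ := (chartAt (EuclideanSpace ℝ (Fin n)) x₀).symm with hψ
  set x := ψ u with hx
  set g := frameMatrix c x₀ u with hg
  let Γ : EuclideanSpace ℝ (Fin n) × (Fin n → ℝ) → M × (Fin n → ℝ) := fun y => (ψ y.1, realAction g y.2)
  have hψd : MDifferentiableAt (𝓡 n) (𝓡 n) ψ u :=
    (isLocalDiffeomorphAt_chartAt_symm hu.1).mdifferentiableAt (by simp)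
  have hfst : MDifferentiableAt 𝓘(ℝ, EuclideanSpace ℝ (Fin n) × (Fin n → ℝ)) (𝓡 n)
      (Prod.fst : EuclideanSpace ℝ (Fin n) × (Fin n → ℝ) → _) (u, w) :=
    differentiableAt_fst.mdifferentiableAt
  have h1 : MDifferentiableAt 𝓘(ℝ, EuclideanSpace ℝ (Fin n) × (Fin n → ℝ)) (𝓡 n)
      (fun y : EuclideanSpace ℝ (Fin n) × (Fin n → ℝ) => ψ y.1) (u, w) :=
    MDifferentiableAt.comp (u, w) (g := ψ) hψd hfst
  have h2 : HasFDerivAt (fun y : EuclideanSpace ℝ (Fin n) × (Fin n → ℝ) => realAction g y.2)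
      ((realAction g).comp (ContinuousLinearMap.snd ℝ _ _)) (u, w) :=
    (realAction g).hasFDerivAt.comp _ hasFDerivAt_snd
  -- Local constancy of the cocycle lets the matrix at `x` serve for all nearby points.
  have hloc : P.localParam x₀ =ᶠ[𝓝 (u, w)] P.param (c.indexAt x) ∘ Γ := by
    have h4 : ∀ᶠ x' in 𝓝 x, x' ∈ c.baseSet (c.indexAt x₀) ∩ c.baseSet (c.indexAt x) :=
      ((c.isOpen_baseSet _).inter (c.isOpen_baseSet _)).mem_nhds ⟨hu.2, c.mem_baseSet_at x⟩
    have h3 : ∀ᶠ x' in 𝓝 x, x' ∈ c.baseSet (c.indexAt x₀) ∩ c.baseSet (c.indexAt x) ∧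
        c.transition (c.indexAt x₀) (c.indexAt x) x' = g :=
      h4.and (c.locallyConstant _ _ x ⟨hu.2, c.mem_baseSet_at x⟩)
    filter_upwards [h1.continuousAt.eventually h3] with y hy
    have := P.param_transition _ _ _ hy.1 y.2
    rw [hy.2] at this
    exact this.symm
  have hΓ : MDifferentiableAt 𝓘(ℝ, EuclideanSpace ℝ (Fin n) × (Fin n → ℝ)) (totalModel n) Γ (u, w) :=
    h1.prodMk h2.differentiableAt.mdifferentiableAt
  have hparam := (P.isLocalDiffeomorphOn_param (c.indexAt x)
    ⟨Γ (u, w), c.mem_baseSet_at x, mem_univ _⟩).mdifferentiableAt (by simp)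
  refine Eq.trans (hloc.mfderiv_eq) ?_
  refine Eq.trans (mfderiv_comp (u, w) hparam hΓ) ?_
  have hmul : ∀ v : EuclideanSpace ℝ (Fin n) × (Fin n → ℝ),
      mfderiv 𝓘(ℝ, EuclideanSpace ℝ (Fin n) × (Fin n → ℝ)) (totalModel n) Γ (u, w) v =
        (chartFrame x₀ u v.1, realAction g v.2) := by
    intro v
    refine (DFunLike.congr_fun (mfderiv_prodMk h1 h2.differentiableAt.mdifferentiableAt) v).trans ?_
    refine Prod.ext ?_ ?_
    · rw [chartFrame_apply hu.1]
      refine (DFunLike.congr_fun (mfderiv_comp (u, w) (g := ψ) hψd hfst) v).trans ?_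
      have : mfderiv 𝓘(ℝ, EuclideanSpace ℝ (Fin n) × (Fin n → ℝ)) (𝓡 n)
        (Prod.fst : EuclideanSpace ℝ (Fin n) × (Fin n → ℝ) → _) (u, w) v = v.1 := by
        rw [mfderiv_eq_fderiv, fderiv_fst]
        rfl
      exact congrArg (mfderiv (𝓡 n) (𝓡 n) ψ u) this
    · have : mfderiv 𝓘(ℝ, EuclideanSpace ℝ (Fin n) × (Fin n → ℝ)) 𝓘(ℝ, Fin n → ℝ)
          (fun y : EuclideanSpace ℝ (Fin n) × (Fin n → ℝ) => realAction g y.2) (u, w) v =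
          realAction g v.2 := by
        rw [mfderiv_eq_fderiv, h2.fderiv]
        rfl
      exact this
  refine ContinuousLinearMap.ext fun v => ?_
  exact congrArg (mfderiv (totalModel n) (totalModel n) (P.param (c.indexAt x)) (Γ (u, w))) (hmul v)

end TorusBundle

end Geometry

/-! ### Structures on the torus bundle induced from the base -/

section Lift
variable {ι M : Type*} {n : ℕ} [TopologicalSpace M] [ChartedSpace (EuclideanSpace ℝ (Fin n)) M]
  [IsManifold (𝓡 n) ∞ M] {c : LatticeCocycle ι M n}
  {Z : Type*} [TopologicalSpace Z]
  [ChartedSpace (ModelProd (EuclideanSpace ℝ (Fin n)) (Fin n → ℝ)) Z]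
  [IsManifold (totalModel n) ∞ Z]

namespace TorusBundle
variable (P : TorusBundle c Z)

/-- A field of endomorphisms of `T_Z ⊕ T_Z^∨` is induced by `K` through the splitting of `T_Z`. -/
def IsInduced (K : BaseField c)
    (J : ∀ z : Z, GenSpace (TangentSpace (totalModel n) z) →ₗ[ℝ] GenSpace (TangentSpace (totalModel n) z)) :
    Prop :=
  ∀ x v, J (P.pointAt x v) =
    (genMap (P.splitting x v)).toLinearMap ∘ₗ K x ∘ₗ (genMap (P.splitting x v)).symm.toLinearMap

variable {P}

/-- Since the differential of `localParam` is the frame followed by the splitting, the splitting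
cancels and the coordinate expression of `J` depends only on the base variable. -/
theorem IsInduced.represents {K : BaseField c}
    {J : ∀ z : Z, GenSpace (TangentSpace (totalModel n) z) →ₗ[ℝ] GenSpace (TangentSpace (totalModel n) z)}
    (h : P.IsInduced K J) (x₀ : M) :
    Represents (P.localParam x₀) (chartDomain c x₀ ×ˢ univ) J (fun y => localField c K x₀ y.1) := by
  rintro ⟨u, w⟩ hy
  have hu : u ∈ chartDomain c x₀ := hy.1
  set x := (chartAt (EuclideanSpace ℝ (Fin n)) x₀).symm u
  set v := realAction (frameMatrix c x₀ u) w
  let L := localFrame c x₀ u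
  let D : (EuclideanSpace ℝ (Fin n) × (Fin n → ℝ)) ≃L[ℝ] TangentSpace (totalModel n) (P.pointAt x v) :=
    L.trans (P.splitting x v)
  -- The statement is generalized over `z` so that the equality of base points can be substituted
  -- inside the dependent types.
  have key : ∀ z : Z, z = P.pointAt x v →
      ∀ D' : (EuclideanSpace ℝ (Fin n) × (Fin n → ℝ)) →L[ℝ] TangentSpace (totalModel n) z,
      @Eq (EuclideanSpace ℝ (Fin n) × (Fin n → ℝ) →L[ℝ] EuclideanSpace ℝ (Fin n) × (Fin n → ℝ))
        D' D.toContinuousLinearMap →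
      ∀ g : GenSpace (TangentSpace (totalModel n) z),
        pull D' (J z g) = localField c K x₀ u (pull D' g) := by
    rintro z rfl D' hD g
    have hD' : D' = D.toContinuousLinearMap := hD
    rw [hD', pull_coe, pull_coe, h]
    have e1 : ∀ b, (genMap D).symm b = (genMap L).symm ((genMap (P.splitting x v)).symm b) :=
      fun b => rfl
    have e2 : ∀ b, localField c K x₀ u b = (genMap L).symm (K x (genMap L b)) := fun b => rfl
    rw [e1, e1, e2, LinearEquiv.apply_symm_apply]
    simp only [LinearMap.comp_apply, LinearEquiv.coe_coe, LinearEquiv.symm_apply_apply]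
  exact key _ (P.localParam_eq_pointAt x₀ hu w) _ (P.mfderiv_localParam x₀ hu w)

theorem IsLift.flatSmooth {K : BaseField c} {J : GenAlmostComplexStructure (totalModel n) Z}
    (h : P.IsLift K J) (x₀ : M) :
    FlatSmooth (fun y => localField c K x₀ y.1) (chartDomain c x₀ ×ˢ univ) :=
  (IsInduced.represents h x₀).flatSmooth ((isOpen_chartDomain x₀).prod isOpen_univ)
    fun _ hy => P.isLocalDiffeomorphAt_localParam x₀ hy

/-- Integrability is local and the parametrizations `localParam x₀` cover `Z`. -/
theorem IsLift.integrable_iff {K : BaseField c} {J : GenAlmostComplexStructure (totalModel n) Z}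
    (h : P.IsLift K J) : J.Integrable ↔
      ∀ x₀, FlatIntegrable (fun y => localField c K x₀ y.1) (chartDomain c x₀ ×ˢ univ) := by
  constructor
  · intro hJ x₀
    exact (IsInduced.represents h x₀).flatIntegrable
      (fun _ hy => P.isLocalDiffeomorphAt_localParam x₀ hy) hJ
  · intro hT U hU a a' b b' ha ha' hb hb' hae hbe z hz
    obtain ⟨x₀, y, hy, rfl⟩ := P.exists_localParam_eq z
    exact (IsInduced.represents h x₀).inEigenspace_courantBracket
      ((isOpen_chartDomain x₀).prod isOpen_univ)
      (fun _ hy => P.isLocalDiffeomorphAt_localParam x₀ hy) (hT x₀) hU ha ha' hb hb' hae hbe hy hz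

variable (P) in
/-- The splitting of the tangent space is invariant under the lattice. -/
theorem splitting_eq {x : M} {v w : Fin n → ℝ} (h : P.pointAt x v = P.pointAt x w) :
    @Eq ((c.V x × TangentSpace (𝓡 n) x) ≃L[ℝ] EuclideanSpace ℝ (Fin n) × (Fin n → ℝ))
      (P.splitting x v) (P.splitting x w) := by
  obtain ⟨k, rfl⟩ := (P.param_eq_iff _ x (c.mem_baseSet_at x) v w).1 h
  let t : Fin n → ℝ := fun a => (k a : ℝ)
  -- Translation by a lattice vector in a fixed trivialization: its differential is the identity,
  -- and the parametrization is invariant under it near `(x, w)`.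
  let τ : M × (Fin n → ℝ) → M × (Fin n → ℝ) := fun p => (p.1, p.2 + t)
  let f := P.param (c.indexAt x)
  have hf : ∀ v, MDifferentiableAt (totalModel n) (totalModel n) f (x, v) := fun v =>
    (P.isLocalDiffeomorphOn_param (c.indexAt x)
      ⟨(x, v), c.mem_baseSet_at x, mem_univ _⟩).mdifferentiableAt (by simp)
  have hsnd : MDifferentiableAt 𝓘(ℝ, Fin n → ℝ) 𝓘(ℝ, Fin n → ℝ) (fun v => v + t) w :=
    (differentiableAt_id.add_const t).mdifferentiableAt
  have hid : MDifferentiableAt (𝓡 n) (𝓡 n) (id : M → M) x := mdifferentiableAt_id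
  have hτ : MDifferentiableAt (totalModel n) (totalModel n) τ (x, w) := hid.prodMap hsnd
  have hτd : ∀ u, mfderiv (totalModel n) (totalModel n) τ (x, w) u = u := by
    intro u
    refine (DFunLike.congr_fun (mfderiv_prodMap (p := (x, w)) hid hsnd) u).trans ?_
    refine Prod.ext ?_ ?_
    · exact DFunLike.congr_fun (mfderiv_id (I := 𝓡 n) (x := x)) u.1
    · have : mfderiv 𝓘(ℝ, Fin n → ℝ) 𝓘(ℝ, Fin n → ℝ) (fun v => v + t) w u.2 = u.2 := by
        rw [mfderiv_eq_fderiv, fderiv_add_const, fderiv_fun_id]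
        rfl
      exact this
  have hloc : f =ᶠ[𝓝 (x, w)] f ∘ τ := by
    have h1 : ∀ᶠ p : M × (Fin n → ℝ) in 𝓝 (x, w), p.1 ∈ c.baseSet (c.indexAt x) :=
      continuousAt_fst.eventually_mem ((c.isOpen_baseSet _).mem_nhds (c.mem_baseSet_at x))
    filter_upwards [h1] with p hp
    exact ((P.param_eq_iff _ p.1 hp (p.2 + t) p.2).2 ⟨k, rfl⟩).symm
  refine ContinuousLinearEquiv.ext (funext fun q => ?_)
  let u : TangentSpace (totalModel n) (x, w) := (q.2, q.1)
  have e1 : mfderiv (totalModel n) (totalModel n) f (x, w) =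
      mfderiv (totalModel n) (totalModel n) (f ∘ τ) (x, w) := hloc.mfderiv_eq
  have e2 : mfderiv (totalModel n) (totalModel n) (f ∘ τ) (x, w) u =
      mfderiv (totalModel n) (totalModel n) f (x, w + t) u := by
    refine (DFunLike.congr_fun (mfderiv_comp (x, w) (hf _) hτ) u).trans ?_
    exact congrArg (mfderiv (totalModel n) (totalModel n) f (x, w + t)) (hτd u)
  exact ((DFunLike.congr_fun e1 u).trans e2).symm

variable (P) in
/-- The field of endomorphisms of `T_Z ⊕ T_Z^∨` induced by `K`. -/
def inducedField (K : BaseField c) (z : Z) :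
    GenSpace (TangentSpace (totalModel n) z) →ₗ[ℝ] GenSpace (TangentSpace (totalModel n) z) :=
  let p := (P.exists_pointAt_eq z).choose
  let e : (c.V p.1 × TangentSpace (𝓡 n) p.1) ≃L[ℝ] TangentSpace (totalModel n) z := P.splitting p.1 p.2
  (genMap e).toLinearMap ∘ₗ K p.1 ∘ₗ (genMap e).symm.toLinearMap

theorem proj_pointAt (x : M) (v : Fin n → ℝ) : P.proj (P.pointAt x v) = x :=
  P.proj_param _ x (c.mem_baseSet_at x) v

/-- The chosen coordinates are immaterial: the point of `Z` determines `x`, and coordinates over it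
that give the same point have the same splitting. -/
theorem isInduced_inducedField (K : BaseField c) : P.IsInduced K (P.inducedField K) := by
  intro x v
  obtain ⟨⟨x', v'⟩, hp⟩ : ∃ p, p = (P.exists_pointAt_eq (P.pointAt x v)).choose := ⟨_, rfl⟩
  have hz := (P.exists_pointAt_eq (P.pointAt x v)).choose_spec
  rw [inducedField]
  rw [← hp] at hz ⊢
  have hx : x' = x := by rw [← proj_pointAt (P := P) x' v', hz, proj_pointAt]
  subst hx
  have := P.splitting_eq hz
  exact congrArg (fun e : (c.V x' × TangentSpace (𝓡 n) x') ≃L[ℝ] TangentSpace (totalModel n) (P.pointAt x' v)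
    => (genMap e).toLinearMap ∘ₗ K x' ∘ₗ (genMap e).symm.toLinearMap) this

variable (P) in
theorem exists_isLift {K : BaseField c} (hK : ∀ x, IsGenComplex (K x))
    (hs : ∀ x₀, FlatSmooth (fun y => localField c K x₀ y.1) (chartDomain c x₀ ×ˢ univ)) :
    ∃ J, P.IsLift K J := by
  refine ⟨⟨P.inducedField K, fun z => isGenComplex_conj _ (hK _), ?_⟩, isInduced_inducedField K⟩
  intro U hU a ha
  rw [isSmoothOn_iff hU] at ha ⊢
  intro z hz
  obtain ⟨x₀, y, hy, rfl⟩ := P.exists_localParam_eq z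
  exact ((isInduced_inducedField K).represents x₀).isSmoothAt_apply
    ((isOpen_chartDomain x₀).prod isOpen_univ) (hs x₀) hy
    (fun _ hy => P.isLocalDiffeomorphAt_localParam x₀ hy) hU hz ha

theorem IsLift.structure_eq {K : BaseField c} {J J' : GenAlmostComplexStructure (totalModel n) Z}
    (h : P.IsLift K J) (h' : P.IsLift K J') : J = J' := by
  have : J.toFun = J'.toFun := by
    funext z
    obtain ⟨⟨x, v⟩, rfl⟩ := P.exists_pointAt_eq z
    rw [h, h']
  cases J
  cases J'
  cases this
  rfl

/-- Evaluating on the zero section and cancelling the splitting recovers the field on the base. -/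
theorem IsLift.baseField_eq {K K' : BaseField c} {J : GenAlmostComplexStructure (totalModel n) Z}
    (h : P.IsLift K J) (h' : P.IsLift K' J) : K = K' := by
  funext x
  refine LinearMap.ext fun a => ?_
  have := (h x 0).symm.trans (h' x 0)
  have h1 := congrArg (fun L => (genMap (P.splitting x 0)).symm (L (genMap (P.splitting x 0) a))) this
  simpa using h1

end TorusBundle

/-! ### The mirror correspondence -/

theorem BaseField.IsAdapted.mirror {K : BaseField c} (hK : K.IsAdapted) : K.mirror.IsAdapted :=
  ⟨fun x => isGenComplex_shuffleConj (hK.isGenComplex x),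
    fun x => shuffleConj_image_leftPart (hK.image_eq x)⟩

theorem BaseField.mirror_injective : Injective (BaseField.mirror : BaseField c → BaseField c.dual) := by
  intro K K' h
  funext x
  exact (shuffleConj_shuffleConj (K x)).symm.trans
    ((congrArg shuffleConj (congrFun h x)).trans (shuffleConj_shuffleConj (K' x)))

/-- The same conjugation, read from the dual side, provides the preimage: the fibres of both bundles
are `ℝⁿ`, so the double dual cocycle need not be compared with `c`. -/
theorem BaseField.IsAdapted.exists_mirror_eq {K' : BaseField c.dual} (hK : K'.IsAdapted) :
    ∃ K : BaseField c, K.IsAdapted ∧ K.mirror = K' :=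
  ⟨fun x => shuffleConj (K' x), ⟨fun x => isGenComplex_shuffleConj (hK.isGenComplex x),
    fun x => shuffleConj_image_leftPart (hK.image_eq x)⟩, funext fun x => shuffleConj_shuffleConj (K' x)⟩

theorem localField_eq_mirror (K : BaseField c) (x₀ : M) (u : EuclideanSpace ℝ (Fin n))
    (a : GenSpace (EuclideanSpace ℝ (Fin n) × (Fin n → ℝ))) :
    localField c K x₀ u a =
      swappedShuffle n _ (localField c.dual K.mirror x₀ u (swappedShuffle n _ a)) := by
  rw [localField_mirror, isHorizontalIsometry_swappedShuffle.involutive,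
    isHorizontalIsometry_swappedShuffle.involutive]

theorem flatSmooth_mirror_iff (K : BaseField c) (x₀ : M) :
    FlatSmooth (fun y => localField c.dual K.mirror x₀ y.1) (chartDomain c.dual x₀ ×ˢ univ) ↔
      FlatSmooth (fun y => localField c K x₀ y.1) (chartDomain c x₀ ×ˢ univ) :=
  ⟨fun h => h.conj _ fun _ _ => localField_eq_mirror K x₀ _,
    fun h => h.conj _ fun _ _ => localField_mirror K x₀ _⟩

/-- The two coordinate fields are conjugate by the same horizontal isometry, which is its own
inverse, so `FlatIntegrable.conj` applies in both directions. -/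
theorem flatIntegrable_mirror_iff {K : BaseField c} (hK : ∀ x, IsGenComplex (K x)) (x₀ : M) :
    FlatIntegrable (fun y => localField c.dual K.mirror x₀ y.1) (chartDomain c.dual x₀ ×ˢ univ) ↔
      FlatIntegrable (fun y => localField c K x₀ y.1) (chartDomain c x₀ ×ˢ univ) :=
  ⟨fun h => FlatIntegrable.conj isHorizontalIsometry_swappedShuffle h
      (fun u _ => isGenComplex_localField hK x₀ u) fun _ _ => localField_eq_mirror K x₀ _,
    fun h => FlatIntegrable.conj isHorizontalIsometry_swappedShuffle h
      (fun u _ => isGenComplex_localField (K := K.mirror) (fun x => isGenComplex_shuffleConj (hK x)) x₀ u)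
      fun _ _ => localField_mirror K x₀ _⟩

namespace TorusBundle
variable {P : TorusBundle c Z} {J : GenAlmostComplexStructure (totalModel n) Z}
  {J' : GenAlmostComplexStructure (totalModel n) c.dual.Torus}

theorem IsSemiFlat.exists_isMirror (h : P.IsSemiFlat J) : ∃ J', P.IsMirror J J' := by
  obtain ⟨K, hK, hJ⟩ := h
  obtain ⟨J', hJ'⟩ := P.dual.exists_isLift (K := K.mirror) hK.mirror.isGenComplex
    fun x₀ => (flatSmooth_mirror_iff K x₀).2 (hJ.flatSmooth x₀)
  exact ⟨J', K, hK, hJ, hJ'⟩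

theorem IsSemiFlat.exists_isMirror_left (h : P.dual.IsSemiFlat J') : ∃ J, P.IsMirror J J' := by
  obtain ⟨K', hK', hJ'⟩ := h
  obtain ⟨K, hK, rfl⟩ := hK'.exists_mirror_eq
  obtain ⟨J, hJ⟩ := P.exists_isLift hK.isGenComplex
    fun x₀ => (flatSmooth_mirror_iff K x₀).1 (hJ'.flatSmooth x₀)
  exact ⟨J, K, hK, hJ, hJ'⟩

theorem IsMirror.isSemiFlat_left (h : P.IsMirror J J') : P.IsSemiFlat J := by
  obtain ⟨K, hK, hJ, -⟩ := h
  exact ⟨K, hK, hJ⟩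

theorem IsMirror.isSemiFlat_right (h : P.IsMirror J J') : P.dual.IsSemiFlat J' := by
  obtain ⟨K, hK, -, hJ'⟩ := h
  exact ⟨K.mirror, hK.mirror, hJ'⟩

theorem IsMirror.unique_right {J'' : GenAlmostComplexStructure (totalModel n) c.dual.Torus}
    (h : P.IsMirror J J') (h' : P.IsMirror J J'') : J' = J'' := by
  obtain ⟨K, -, hK, hJ'⟩ := h
  obtain ⟨K₂, -, hK₂, hJ''⟩ := h'
  cases hK.baseField_eq hK₂
  exact hJ'.structure_eq hJ''

theorem IsMirror.unique_left {J₂ : GenAlmostComplexStructure (totalModel n) Z}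
    (h : P.IsMirror J J') (h' : P.IsMirror J₂ J') : J = J₂ := by
  obtain ⟨K, -, hK, hJ'⟩ := h
  obtain ⟨K₂, -, hK₂, hJ₂'⟩ := h'
  cases BaseField.mirror_injective (hJ'.baseField_eq hJ₂')
  exact hK.structure_eq hK₂

theorem IsMirror.integrable_iff (h : P.IsMirror J J') : J.Integrable ↔ J'.Integrable := by
  obtain ⟨K, hK, hJ, hJ'⟩ := h
  rw [hJ.integrable_iff, hJ'.integrable_iff]
  exact forall_congr' fun x₀ => (flatIntegrable_mirror_iff hK.isGenComplex x₀).symm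

end TorusBundle

end Lift

end SemiFlat

end

/-! ### The mirror bijection -/

theorem mainTheorem4 {ι M Z : Type*} {n : ℕ} [TopologicalSpace M]
    [ChartedSpace (EuclideanSpace ℝ (Fin n)) M] [IsManifold (𝓡 n) ∞ M]
    [TopologicalSpace Z] [ChartedSpace (ModelProd (EuclideanSpace ℝ (Fin n)) (Fin n → ℝ)) Z]
    [IsManifold (SemiFlat.LatticeCocycle.totalModel n) ∞ Z]
    (c : SemiFlat.LatticeCocycle ι M n) (P : SemiFlat.TorusBundle c Z) :
    (∀ J, P.IsSemiFlat J → ∃! J', P.IsMirror J J') ∧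
    (∀ J J', P.IsMirror J J' → P.dual.IsSemiFlat J' ∧ (J.Integrable ↔ J'.Integrable)) ∧
    (∃ e : {J // P.IsSemiFlat J ∧ J.Integrable} ≃ {J' // P.dual.IsSemiFlat J' ∧ J'.Integrable},
      ∀ J, P.IsMirror J.1 (e J).1) := by
  refine ⟨fun J hJ => ?_, fun J J' h => ⟨h.isSemiFlat_right, h.integrable_iff⟩, ?_⟩
  · obtain ⟨J', hJ'⟩ := hJ.exists_isMirror
    exact ⟨J', hJ', fun J'' h => h.unique_right hJ'⟩
  · choose f hf using fun J : {J // P.IsSemiFlat J ∧ J.Integrable} => J.2.1.exists_isMirror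
    let F : {J // P.IsSemiFlat J ∧ J.Integrable} → {J' // P.dual.IsSemiFlat J' ∧ J'.Integrable} :=
      fun J => ⟨f J, (hf J).isSemiFlat_right, (hf J).integrable_iff.1 J.2.2⟩
    have hF : Function.Bijective F := by
      constructor
      · intro J₁ J₂ h
        have h1 : f J₁ = f J₂ := congrArg Subtype.val h
        have h2 := hf J₁
        rw [h1] at h2
        exact Subtype.ext (h2.unique_left (hf J₂))
      · rintro ⟨J', hJ', hi⟩
        obtain ⟨J, hJ⟩ := SemiFlat.TorusBundle.IsSemiFlat.exists_isMirror_left hJ'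
        exact ⟨⟨J, hJ.isSemiFlat_left, hJ.integrable_iff.2 hi⟩, Subtype.ext ((hf _).unique_right hJ)⟩
    exact ⟨Equiv.ofBijective F hF, fun J => hf J⟩
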